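/- Let $(M,g)$ be a compact connected smooth Riemannian manifold without boundary, of dimension $n>2$, with Levi-Civita connection $\nabla$, curvature tensor $R(X,Y)Z=\nabla_X\nabla_YZ-\nabla_Y\nabla_XZ-\nabla_{[X,Y]}Z$, Ricci tensor $\operatorname{Ric}(X,Y)=\sum_{i=1}^n g(R(e_i,X)Y,e_i)$ (for a local orthonormal frame $e_1,\dots,e_n$) and scalar curvature $S$. Let $\xi$ be a smooth vector field, $\lambda$ a smooth function on $M$ and $\rho\in\mathbb{R}$ such that $(M,g,\xi,\lambda,\rho)$ is an almost Ricci–Bourguignon soliton (almost RB-soliton), that is, $$\operatorname{Ric}+\tfrac12\mathcal{L}_\xi g=(\lambda+\rho S)\,g .$$ Let $\eta=g(\xi,\cdot)$, let $\varphi$ be the skew-symmetric operator defined by $\tfrac12\,d\eta(X,Y)=g(\varphi X,Y)$, where $d\eta(X,Y)=X\eta(Y)-Y\eta(X)-\eta([X,Y])$ (so $\varphi$ is the skew part of $\nabla\xi$), and let $\|\varphi\|^2=\sum_{i=1}^n g(\varphi e_i,\varphi e_i)$. Assume that $\operatorname{Ric}(\xi,\xi)\ge\|\varphi\|^2$ on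 $M$. Then the function $(n-1)(\lambda+\rho S)-S$ is constant on each integral curve of $\xi$ if and only if $(M,g,\xi,\lambda,\rho)$ is a trivial RB-soliton, that is, $\lambda$ is constant and $\xi$ is a Killing field ($\mathcal{L}_\xi g=0$). -/

import Mathlib

open Bundle NormedSpace FiberBundle Set VectorField
open scoped Manifold ContDiff Topology

set_option linter.unusedSectionVars false

noncomputable section

namespace RBSoliton

variable
  {E : Type*} [NormedAddCommGroup E] [NormedSpace ℝ E] [FiniteDimensional ℝ E]
  {H : Type*} [TopologicalSpace H] {I : ModelWithCorners ℝ E H}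
  {M : Type*} [TopologicalSpace M] [ChartedSpace H M] [IsManifold I ∞ M]
  [RiemannianBundle (fun x : M => TangentSpace I x)]
  [IsContMDiffRiemannianBundle I ∞ E (fun x : M => TangentSpace I x)]

instance tangentSpaceFiniteDimensional (x : M) : FiniteDimensional ℝ (TangentSpace I x) :=
  inferInstanceAs (FiniteDimensional ℝ E)

/-- The Koszul expression for `g(∇_X Y, Z)` at the point `x`, where `∇` is the Levi-Civita
connection of the Riemannian metric `g = inner ℝ`. -/
def koszul (X Y Z : Π x : M, TangentSpace I x) (x : M) : ℝ :=
  (mvfderiv I (fun y => inner ℝ (Y y) (Z y)) x (X x)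
    + mvfderiv I (fun y => inner ℝ (X y) (Z y)) x (Y x)
    - mvfderiv I (fun y => inner ℝ (X y) (Y y)) x (Z x)
    + inner ℝ (mlieBracket I X Y x) (Z x)
    - inner ℝ (mlieBracket I X Z x) (Y x)
    - inner ℝ (mlieBracket I Y Z x) (X x)) / 2

theorem mdifferentiableAt_inner {x : M} {Y Z : Π x : M, TangentSpace I x}
    (hY : MDiffAt (T% Y) x) (hZ : MDiffAt (T% Z) x) :
    MDiffAt (fun y => inner ℝ (Y y) (Z y)) x :=
  MDifferentiableAt.inner_bundle (F := E) (E := fun x : M => TangentSpace I x)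
    (b := fun y : M => y) hY hZ

theorem koszul_tensorial_left {x : M} {Y Z : Π x : M, TangentSpace I x}
    (hY : MDiffAt (T% Y) x) (hZ : MDiffAt (T% Z) x) :
    TensorialAt I E (fun X => koszul X Y Z x) x where
  smul {f X} hf hX := by
    have h1 := mvfderiv_fun_mul hf (mdifferentiableAt_inner hX hZ)
    have h2 := mvfderiv_fun_mul hf (mdifferentiableAt_inner hX hY)
    have : CompleteSpace E := FiniteDimensional.complete ℝ E
    simp [koszul, inner_smul_left, inner_smul_right, h1, h2, mlieBracket_smul_left hf hX,
      inner_add_left]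
    simp only [real_inner_comm]
    ring
  add {X X'} hX hX' := by
    have h1 := mvfderiv_fun_add (mdifferentiableAt_inner hX hZ) (mdifferentiableAt_inner hX' hZ)
    have h2 := mvfderiv_fun_add (mdifferentiableAt_inner hX hY) (mdifferentiableAt_inner hX' hY)
    have : CompleteSpace E := FiniteDimensional.complete ℝ E
    simp [koszul, inner_add_left, inner_add_right, h1, h2, mlieBracket_add_left hX hX']
    ring

theorem koszul_tensorial_right {x : M} {X Y : Π x : M, TangentSpace I x}
    (hX : MDiffAt (T% X) x) (hY : MDiffAt (T% Y) x) :
    TensorialAt I E (fun Z => koszul X Y Z x) x where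
  smul {f Z} hf hZ := by
    have h1 := mvfderiv_fun_mul hf (mdifferentiableAt_inner hY hZ)
    have h2 := mvfderiv_fun_mul hf (mdifferentiableAt_inner hX hZ)
    have : CompleteSpace E := FiniteDimensional.complete ℝ E
    simp [koszul, inner_smul_left, inner_smul_right, h1, h2, mlieBracket_smul_right hf hZ,
      inner_add_left]
    rw [real_inner_comm (Z x) (Y x), real_inner_comm (Z x) (X x)]
    ring
  add {Z Z'} hZ hZ' := by
    have h1 := mvfderiv_fun_add (mdifferentiableAt_inner hY hZ) (mdifferentiableAt_inner hY hZ')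
    have h2 := mvfderiv_fun_add (mdifferentiableAt_inner hX hZ) (mdifferentiableAt_inner hX hZ')
    have : CompleteSpace E := FiniteDimensional.complete ℝ E
    simp [koszul, inner_add_left, inner_add_right, h1, h2, mlieBracket_add_right hZ hZ']
    ring

/-- For a vector field `Y` differentiable at `x`, the bilinear form
`(v, w) ↦ g(∇_v Y, w)` on the tangent space at `x`. -/
def koszulForm (Y : Π x : M, TangentSpace I x) (x : M) (hY : MDiffAt (T% Y) x) :
    TangentSpace I x →L[ℝ] TangentSpace I x →L[ℝ] ℝ :=
  TensorialAt.mkHom₂ (I := I) (F := E) (F' := E) (fun X Z => koszul X Y Z x) x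
    (fun _ hZ => koszul_tensorial_left hY hZ) (fun _ hX => koszul_tensorial_right hX hY)

open Classical in
/-- The covariant derivative `v ↦ ∇_v Y` at `x`: for `Y` differentiable at `x` it is the vector
representing `w ↦ g(∇_v Y, w)` with respect to `g`. -/
def leviCivitaFun (Y : Π x : M, TangentSpace I x) (x : M) :
    TangentSpace I x →L[ℝ] TangentSpace I x :=
  if hY : MDiffAt (T% Y) x then
    haveI : CompleteSpace (TangentSpace I x) := FiniteDimensional.complete ℝ _
    InnerProductSpace.continuousLinearMapOfBilin (𝕜 := ℝ) (koszulForm Y x hY)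
  else 0

/-- The Koszul formula characterises `leviCivitaFun`. -/
theorem inner_leviCivitaFun {x : M} {X Y Z : Π x : M, TangentSpace I x}
    (hX : MDiffAt (T% X) x) (hY : MDiffAt (T% Y) x) (hZ : MDiffAt (T% Z) x) :
    inner ℝ (leviCivitaFun Y x (X x)) (Z x) = koszul X Y Z x := by
  have : CompleteSpace (TangentSpace I x) := FiniteDimensional.complete ℝ _
  rw [leviCivitaFun, dif_pos hY]
  refine (InnerProductSpace.continuousLinearMapOfBilin_apply _ _ _).trans ?_
  exact TensorialAt.mkHom₂_apply (I := I) (F := E) (F' := E) _ _ hX hZ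

theorem koszul_add_middle {x : M} {X Y Y' Z : Π x : M, TangentSpace I x}
    (hX : MDiffAt (T% X) x) (hY : MDiffAt (T% Y) x) (hY' : MDiffAt (T% Y') x)
    (hZ : MDiffAt (T% Z) x) :
    koszul X (Y + Y') Z x = koszul X Y Z x + koszul X Y' Z x := by
  have h1 := mvfderiv_fun_add (mdifferentiableAt_inner hY hZ) (mdifferentiableAt_inner hY' hZ)
  have h2 := mvfderiv_fun_add (mdifferentiableAt_inner hX hY) (mdifferentiableAt_inner hX hY')
  have : CompleteSpace E := FiniteDimensional.complete ℝ E
  simp [koszul, inner_add_left, inner_add_right, h1, h2, mlieBracket_add_left hY hY',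
    mlieBracket_add_right hY hY']
  ring

theorem koszul_smul_middle {x : M} {f : M → ℝ} {X Y Z : Π x : M, TangentSpace I x}
    (hf : MDiffAt f x) (hX : MDiffAt (T% X) x) (hY : MDiffAt (T% Y) x)
    (hZ : MDiffAt (T% Z) x) :
    koszul X (f • Y) Z x = f x * koszul X Y Z x + mvfderiv I f x (X x) * inner ℝ (Y x) (Z x) := by
  have h1 := mvfderiv_fun_mul hf (mdifferentiableAt_inner hY hZ)
  have h2 := mvfderiv_fun_mul hf (mdifferentiableAt_inner hX hY)
  have : CompleteSpace E := FiniteDimensional.complete ℝ E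
  simp [koszul, inner_smul_left, inner_smul_right, h1, h2, mlieBracket_smul_left hf hY,
    mlieBracket_smul_right hf hY, inner_add_left]
  rw [real_inner_comm (X x) (Y x)]
  ring

theorem inner_leviCivitaFun_extend {x : M} {Y : Π x : M, TangentSpace I x}
    (hY : MDiffAt (T% Y) x) (v w : TangentSpace I x) :
    inner ℝ (leviCivitaFun Y x v) w = koszul (extend E v) Y (extend E w) x := by
  have h := inner_leviCivitaFun (mdifferentiableAt_extend I E v) hY
    (mdifferentiableAt_extend I E w)
  rwa [extend_apply_self, extend_apply_self] at h

theorem isCovariantDerivativeOn_leviCivitaFun :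
    IsCovariantDerivativeOn (I := I) (M := M) E (leviCivitaFun (I := I) (M := M)) univ where
  add {Y Y' x} hY hY' _ := by
    ext v
    refine ext_inner_right ℝ fun w => ?_
    rw [inner_leviCivitaFun_extend (mdifferentiableAt_add_section hY hY'),
      add_apply, inner_add_left, inner_leviCivitaFun_extend hY,
      inner_leviCivitaFun_extend hY',
      koszul_add_middle (mdifferentiableAt_extend I E v) hY hY' (mdifferentiableAt_extend I E w)]
  leibniz {Y f x} hY hf _ := by
    ext v
    refine ext_inner_right ℝ fun w => ?_
    rw [inner_leviCivitaFun_extend (hf.smul_section hY),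
      add_apply, inner_add_left, smul_apply,
      inner_smul_left, inner_leviCivitaFun_extend hY,
      ContinuousLinearMap.smulRight_apply, inner_smul_left,
      koszul_smul_middle hf (mdifferentiableAt_extend I E v) hY (mdifferentiableAt_extend I E w)]
    simp

variable (I M) in
/-- The Levi-Civita connection of the Riemannian manifold `M`. As for every `CovariantDerivative`,
`leviCivita I M Y x v` is `∇_v Y`. -/
def leviCivita : CovariantDerivative I E (TangentSpace I : M → Type _) where
  toFun := leviCivitaFun
  isCovariantDerivativeOnUniv := isCovariantDerivativeOn_leviCivitaFun

/-- The Levi-Civita connection is torsion-free. -/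
theorem leviCivita_torsion_free {x : M} {X Y : Π x : M, TangentSpace I x}
    (hX : MDiffAt (T% X) x) (hY : MDiffAt (T% Y) x) :
    leviCivita I M Y x (X x) - leviCivita I M X x (Y x) = mlieBracket I X Y x := by
  refine ext_inner_right ℝ fun w => ?_
  have hw := mdifferentiableAt_extend I E w
  have h1 := inner_leviCivitaFun hX hY hw
  have h2 := inner_leviCivitaFun hY hX hw
  have h3 : mlieBracket I Y X x = - mlieBracket I X Y x := mlieBracket_swap_apply
  have h4 : (fun y => inner ℝ (X y) (Y y)) = fun y => inner ℝ (Y y) (X y) := by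
    funext y; exact real_inner_comm _ _
  rw [extend_apply_self] at h1 h2
  rw [inner_sub_left]
  change inner ℝ (leviCivitaFun Y x (X x)) w - inner ℝ (leviCivitaFun X x (Y x)) w = _
  rw [h1, h2]
  simp only [koszul, h3, h4, extend_apply_self, inner_neg_left]
  ring

/-- The Levi-Civita connection is compatible with the metric. -/
theorem leviCivita_metric {x : M} {X Y Z : Π x : M, TangentSpace I x}
    (hX : MDiffAt (T% X) x) (hY : MDiffAt (T% Y) x) (hZ : MDiffAt (T% Z) x) :
    mvfderiv I (fun y => inner ℝ (Y y) (Z y)) x (X x) =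
      inner ℝ (leviCivita I M Y x (X x)) (Z x) + inner ℝ (Y x) (leviCivita I M Z x (X x)) := by
  have h1 := inner_leviCivitaFun hX hY hZ
  have h2 := inner_leviCivitaFun hX hZ hY
  have h3 : mlieBracket I Z Y x = - mlieBracket I Y Z x := mlieBracket_swap_apply
  have h4 : (fun y => inner ℝ (Z y) (Y y)) = fun y => inner ℝ (Y y) (Z y) := by
    funext y; exact real_inner_comm _ _
  rw [← real_inner_comm (Y x)]
  change _ = inner ℝ (leviCivitaFun Y x (X x)) (Z x) + inner ℝ (leviCivitaFun Z x (X x)) (Y x)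
  rw [h1, h2]
  simp only [koszul, h3, h4, inner_neg_left]
  ring

/-- The Riemann curvature tensor
`R(X, Y) Z = ∇_X ∇_Y Z - ∇_Y ∇_X Z - ∇_{[X, Y]} Z` on vector fields, at the point `x`. -/
def curvature (X Y Z : Π x : M, TangentSpace I x) (x : M) : TangentSpace I x :=
  leviCivita I M (fun y => leviCivita I M Z y (Y y)) x (X x)
    - leviCivita I M (fun y => leviCivita I M Z y (X y)) x (Y x)
    - leviCivita I M Z x (mlieBracket I X Y x)

variable (I) in
/-- An orthonormal basis of the tangent space at `x`. -/
def frame (x : M) :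
    OrthonormalBasis (Fin (Module.finrank ℝ (TangentSpace I x))) ℝ (TangentSpace I x) :=
  stdOrthonormalBasis ℝ (TangentSpace I x)

/-- The Ricci tensor `Ric(u, v) = ∑ i, g(R(e i, u) v, e i)` for tangent vectors `u`, `v` at `x`,
with `e` an orthonormal basis of the tangent space. The curvature is tensorial, so it is evaluated
on tangent vectors by extending them to vector fields that are smooth near `x`. -/
def ricci (x : M) (u v : TangentSpace I x) : ℝ :=
  ∑ i, inner ℝ (curvature (extend E (frame I x i)) (extend E u) (extend E v) x) (frame I x i)

variable (I) in
/-- The scalar curvature, the trace of the Ricci tensor. -/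
def scalarCurvature (x : M) : ℝ :=
  ∑ i, ricci x (frame I x i) (frame I x i)

/-- The Lie derivative of the metric along `ξ`,
`(L_ξ g)(X, Y) = ξ (g(X, Y)) - g([ξ, X], Y) - g(X, [ξ, Y])`, at the point `x`. -/
def lieDerivMetric (ξ X Y : Π x : M, TangentSpace I x) (x : M) : ℝ :=
  mvfderiv I (fun y => inner ℝ (X y) (Y y)) x (ξ x)
    - inner ℝ (mlieBracket I ξ X x) (Y x) - inner ℝ (X x) (mlieBracket I ξ Y x)

/-- The exterior derivative `dη(X, Y) = X (η(Y)) - Y (η(X)) - η([X, Y])` of the `1`-form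
`η = g(ξ, ·)` dual to `ξ`, at the point `x`. -/
def extDerivDual (ξ X Y : Π x : M, TangentSpace I x) (x : M) : ℝ :=
  mvfderiv I (fun y => inner ℝ (ξ y) (Y y)) x (X x)
    - mvfderiv I (fun y => inner ℝ (ξ y) (X y)) x (Y x)
    - inner ℝ (ξ x) (mlieBracket I X Y x)

/-- The skew-symmetric operator `φ` on the tangent space at `x` that is defined by
`g(φ u, v) = dη(u, v) / 2` for all tangent vectors `v`; its components with respect to the
orthonormal basis `e` are `dη(u, e j) / 2`. -/
def skewOperator (ξ : Π x : M, TangentSpace I x) (x : M) (u : TangentSpace I x) :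
    TangentSpace I x :=
  ∑ j, (extDerivDual ξ (extend E u) (extend E (frame I x j)) x / 2) • frame I x j

/-- `‖φ‖² = ∑ i, g(φ (e i), φ (e i))` at the point `x`. -/
def skewOperatorNormSq (ξ : Π x : M, TangentSpace I x) (x : M) : ℝ :=
  ∑ i, inner ℝ (skewOperator ξ x (frame I x i)) (skewOperator ξ x (frame I x i))

/-- A smooth vector field on `M`. -/
def IsSmoothField (X : Π x : M, TangentSpace I x) : Prop :=
  ContMDiff I I.tangent ∞ (T% X)

/-- `(M, g, ξ, lam, ρ)` is an almost Ricci-Bourguignon soliton: `ξ` is a smooth vector field,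
`lam` a smooth function, `ρ` a real constant, and
`Ric + (1/2) L_ξ g = (lam + ρ S) g`, where `S` is the scalar curvature. -/
structure IsAlmostRBSoliton (ξ : Π x : M, TangentSpace I x) (lam : M → ℝ) (ρ : ℝ) : Prop where
  smooth_field : IsSmoothField ξ
  smooth_function : ContMDiff I 𝓘(ℝ, ℝ) ∞ lam
  equation : ∀ X Y : Π x : M, TangentSpace I x, IsSmoothField X → IsSmoothField Y → ∀ x : M,
    ricci x (X x) (Y x) + 1 / 2 * lieDerivMetric ξ X Y x
      = (lam x + ρ * scalarCurvature I x) * inner ℝ (X x) (Y x)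

/-- `ξ` is a Killing field: `L_ξ g = 0`. -/
def IsKillingField (ξ : Π x : M, TangentSpace I x) : Prop :=
  IsSmoothField ξ ∧ ∀ X Y : Π x : M, TangentSpace I x, IsSmoothField X → IsSmoothField Y →
    ∀ x : M, lieDerivMetric ξ X Y x = 0

/-- `(M, g, ξ, lam, ρ)` is a trivial Ricci-Bourguignon soliton: it is an almost
Ricci-Bourguignon soliton, the function `lam` is constant, and `ξ` is a Killing field. -/
structure IsTrivialRBSoliton (ξ : Π x : M, TangentSpace I x) (lam : M → ℝ) (ρ : ℝ) : Prop where
  isAlmostRBSoliton : IsAlmostRBSoliton ξ lam ρ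
  constant : ∃ c : ℝ, ∀ x : M, lam x = c
  killing : IsKillingField ξ

/-- The function `F` is constant on every integral curve of the vector field `ξ`. -/
def IsConstantOnIntegralCurves (F : M → ℝ) (ξ : Π x : M, TangentSpace I x) : Prop :=
  ∀ (γ : ℝ → M) (a b : ℝ), IsMIntegralCurveOn γ ξ (Ioo a b) →
    ∀ s ∈ Ioo a b, ∀ t ∈ Ioo a b, F (γ s) = F (γ t)

end RBSoliton

end

open Bundle NormedSpace FiberBundle Set VectorField
open scoped Manifold ContDiff Topology

set_option linter.unusedSectionVars false

noncomputable section

namespace RBSoliton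

variable
  {E : Type*} [NormedAddCommGroup E] [NormedSpace ℝ E] [FiniteDimensional ℝ E]
  {H : Type*} [TopologicalSpace H] {I : ModelWithCorners ℝ E H}
  {M : Type*} [TopologicalSpace M] [ChartedSpace H M] [IsManifold I ∞ M]
  [RiemannianBundle (fun x : M => TangentSpace I x)]
  [IsContMDiffRiemannianBundle I ∞ E (fun x : M => TangentSpace I x)]

/-! Write f = λ + ρS, d = div ξ, A = ½ L_ξ g (`symmForm`) and F = (n-1)f - S. The soliton equation
reads Ric = f g - A, and its trace gives d = nf - S, hence F = d - f. Everything rests on one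
integral formula.

By the contracted Bianchi identity, div(Ric ξ) = ½ ξ(S) + ⟨Ric, ∇ξ⟩. Since A is symmetric, it pairs
with ∇ξ as with its own symmetric part, so ⟨Ric, ∇ξ⟩ = f d - |A|². Suppose F is constant along ξ, so
ξ(F) = 0, and put c = (n/2 - 1)F + S/2. Then ξ(c) = ½ ξ(S) and c - f = (n-3)d/2, so the field cξ -
Ric ξ (`solitonField`) has divergence |A|² + (n-3)d²/2
(`IsAlmostRBSoliton.divergence_solitonField`). For n ≥ 3 this is nonnegative. On a compact manifold
without boundary it must therefore vanish (`divergence_eq_zero_of_nonneg`), so A = 0 and ξ is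
Killing.

Once A = 0, Ric = f g, and Schur's lemma (`mvfderiv_eq_zero_of_ricci_eq`) makes f constant on the
connected M. Then S = nf and λ = f - ρS are constant. The converse uses the same remark: for Killing
ξ both f and S are constant, and so is F.

The divergence theorem is proved by hand. In a chart, div times the density √det(g_ij) is a sum of
partial derivatives, so a field supported in one chart has divergence of integral zero. A partition
of unity and the change of variables between charts globalise this without constructing a volume
measure on M. -/

/-- The vector field `X` is smooth at `x`. -/
def SmoothAt (X : Π x : M, TangentSpace I x) (x : M) : Prop :=
  ContMDiffAt I I.tangent ∞ (T% X) x

/-- The covariant derivative `∇_X Y` as a vector field. -/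
def nabla (X Y : Π x : M, TangentSpace I x) : Π x : M, TangentSpace I x :=
  fun y => leviCivita I M Y y (X y)

/-! ### Smooth fields, derivatives along fields, and the Koszul expression. -/

section Calculus

variable {X Y Z W X' Y' Z' : Π x : M, TangentSpace I x} {f g : M → ℝ} {x : M}

theorem SmoothAt.mdifferentiableAt (hX : SmoothAt X x) : MDiffAt (T% X) x :=
  ContMDiffAt.mdifferentiableAt hX (by simp)

theorem SmoothAt.eventually_mdifferentiableAt (hX : SmoothAt X x) :
    ∀ᶠ y in 𝓝 x, MDiffAt (T% X) y := by
  have h : CMDiffAt 1 (T% X) x := ContMDiffAt.of_le hX (by exact_mod_cast le_top)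
  filter_upwards [(contMDiffAt_iff_contMDiffAt_nhds (by simp)).1 h] with y hy
  exact hy.mdifferentiableAt one_ne_zero

theorem SmoothAt.congr (hX : SmoothAt X x) (h : X' =ᶠ[𝓝 x] X) : SmoothAt X' x := by
  refine ContMDiffAt.congr_of_eventuallyEq (f := T% X) hX ?_
  filter_upwards [h] with y hy
  rw [hy]

theorem SmoothAt.add (hX : SmoothAt X x) (hY : SmoothAt Y x) : SmoothAt (X + Y) x :=
  ContMDiffAt.add_section hX hY

theorem SmoothAt.sub (hX : SmoothAt X x) (hY : SmoothAt Y x) : SmoothAt (X - Y) x :=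
  ContMDiffAt.sub_section hX hY

theorem SmoothAt.smul (hf : CMDiffAt ∞ f x) (hX : SmoothAt X x) : SmoothAt (f • X) x :=
  ContMDiffAt.smul_section hf hX

theorem SmoothAt.sum {ι : Type*} {s : Finset ι} {X : ι → Π x : M, TangentSpace I x}
    (hX : ∀ i ∈ s, SmoothAt (X i) x) : SmoothAt (fun y => ∑ i ∈ s, X i y) x :=
  ContMDiffAt.sum_section hX

theorem smoothAt_extend (v : TangentSpace I x) : SmoothAt (extend E v) x :=
  contMDiffAt_extend I E v

theorem SmoothAt.inner (hX : SmoothAt X x) (hY : SmoothAt Y x) :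
    CMDiffAt ∞ (fun y => inner ℝ (X y) (Y y)) x :=
  ContMDiffAt.inner_bundle (F := E) (E := fun x : M => TangentSpace I x) (b := fun y : M => y)
    hX hY

theorem SmoothAt.mlieBracket (hX : SmoothAt X x) (hY : SmoothAt Y x) :
    SmoothAt (mlieBracket I X Y) x := by
  have : CompleteSpace E := FiniteDimensional.complete ℝ E
  have : IsManifold I ((⊤ : ℕ∞) + 1) M := ‹IsManifold I ∞ M›
  have : IsManifold I (minSmoothness ℝ 2) M := by simp only [minSmoothness_of_isRCLikeNormedField]; infer_instance
  exact ContMDiffAt.mlieBracket_vectorField (m := ⊤) (n := ⊤) hX hY (by simp)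

/-- The differential is smooth when read in trivializations. It is applied to `X` there, and the
resulting map into the tangent bundle of ℝ is projected to its fibre. -/
theorem SmoothAt.mvfderiv_apply (hf : CMDiffAt ∞ f x) (hX : SmoothAt X x) :
    CMDiffAt ∞ (fun y => mvfderiv I f y (X y)) x := by
  have hϕ : CMDiffAt ∞ (fun y => ContinuousLinearMap.inCoordinates E (TangentSpace I (M := M)) ℝ
      (TangentSpace 𝓘(ℝ, ℝ) (M := ℝ)) x y (f x) (f y) (mfderiv I 𝓘(ℝ, ℝ) f y)) x :=
    ContMDiffAt.mfderiv_const hf (by simp)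
  have h := ContMDiffAt.clm_apply_of_inCoordinates hϕ hX hf
  exact ((contMDiff_snd_tangentBundle_modelSpace ℝ 𝓘(ℝ, ℝ)).contMDiffAt).comp x h

/-- The connection is defined pointwise by Riesz representation, which carries no smoothness. This
supplies the smoothness of its components. -/
theorem contMDiffAt_koszul (hX : SmoothAt X x) (hY : SmoothAt Y x) (hZ : SmoothAt Z x) :
    CMDiffAt ∞ (koszul X Y Z) x := by
  have h1 := SmoothAt.mvfderiv_apply (hY.inner hZ) hX
  have h2 := SmoothAt.mvfderiv_apply (hX.inner hZ) hY
  have h3 := SmoothAt.mvfderiv_apply (hX.inner hY) hZ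
  have h4 := (hX.mlieBracket hY).inner hZ
  have h5 := (hX.mlieBracket hZ).inner hY
  have h6 := (hY.mlieBracket hZ).inner hX
  have := ((((h1.add h2).sub h3).add h4).sub h5).sub h6
  exact this.div_const 2

end Calculus

/-! ### Local orthonormal frames. -/

variable (I M) in
/-- A local orthonormal frame of smooth vector fields on the open set `U`. -/
structure IsOrthonormalFrameOn (e : Fin (Module.finrank ℝ E) → Π x : M, TangentSpace I x)
    (U : Set M) : Prop where
  isOpen : IsOpen U
  smoothAt : ∀ i, ∀ y ∈ U, SmoothAt (e i) y
  orthonormal : ∀ y ∈ U, Orthonormal ℝ (fun i => e i y)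

/-- Gram–Schmidt applied to the local frame of a trivialization. Each step divides only by squared
norms that do not vanish, by linear independence, so strong induction on the index keeps the fields
smooth. The square roots in the normalisation are smooth for the same reason. -/
theorem exists_isOrthonormalFrameOn (x : M) :
    ∃ (e : Fin (Module.finrank ℝ E) → Π x : M, TangentSpace I x) (U : Set M),
      x ∈ U ∧ IsOrthonormalFrameOn I M e U := by
  classical
  set t := trivializationAt E (TangentSpace I : M → Type _) x
  set s := t.localFrame (Module.finBasis ℝ E) with hs
  have hfr := t.isLocalFrameOn_localFrame_baseSet I ∞ (Module.finBasis ℝ E)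
  have hli : ∀ y ∈ t.baseSet, LinearIndependent ℝ (fun i => s i y) := fun y hy =>
    hfr.linearIndependent hy
  have hsmooth : ∀ i, ∀ y ∈ t.baseSet, SmoothAt (s i) y := fun i y hy =>
    hfr.contMDiffAt t.open_baseSet hy i
  have hgs : ∀ i, ∀ y ∈ t.baseSet,
      SmoothAt (fun z => InnerProductSpace.gramSchmidt ℝ (fun i => s i z) i) y := by
    intro i
    induction i using WellFoundedLT.induction with
    | ind i ih =>
      intro y hy
      have hsum : SmoothAt (fun z => ∑ j ∈ Finset.Iio i,
          ((fun z => inner ℝ (InnerProductSpace.gramSchmidt ℝ (fun i => s i z) j) (s i z) /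
            inner ℝ (InnerProductSpace.gramSchmidt ℝ (fun i => s i z) j)
              (InnerProductSpace.gramSchmidt ℝ (fun i => s i z) j)) •
            fun z => InnerProductSpace.gramSchmidt ℝ (fun i => s i z) j) z) y := by
        refine SmoothAt.sum fun j hj => ?_
        have hj' := ih j (Finset.mem_Iio.1 hj) y hy
        refine SmoothAt.smul (ContMDiffAt.div₀ (hj'.inner (hsmooth i y hy)) (hj'.inner hj') ?_) hj'
        exact inner_self_ne_zero.2 (InnerProductSpace.gramSchmidt_ne_zero j (hli y hy))
      refine ((hsmooth i y hy).sub hsum).congr (Filter.Eventually.of_forall fun z => ?_)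
      simp only [Pi.sub_apply, Pi.smul_apply']
      rw [InnerProductSpace.gramSchmidt_def]
      congr 1
      refine Finset.sum_congr rfl fun j _ => ?_
      rw [Submodule.starProjection_singleton, real_inner_self_eq_norm_sq]
      rfl
  refine ⟨fun i z => InnerProductSpace.gramSchmidtNormed ℝ (fun i => s i z) i, t.baseSet,
    FiberBundle.mem_baseSet_trivializationAt' x, t.open_baseSet, fun i y hy => ?_, fun y hy =>
      InnerProductSpace.gramSchmidtNormed_orthonormal (hli y hy)⟩
  have h := hgs i y hy
  have hne : inner ℝ (InnerProductSpace.gramSchmidt ℝ (fun i => s i y) i)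
      (InnerProductSpace.gramSchmidt ℝ (fun i => s i y) i) ≠ 0 :=
    inner_self_ne_zero.2 (InnerProductSpace.gramSchmidt_ne_zero i (hli y hy))
  have hn : CMDiffAt ∞ (fun z => (Real.sqrt
      (inner ℝ (InnerProductSpace.gramSchmidt ℝ (fun i => s i z) i)
        (InnerProductSpace.gramSchmidt ℝ (fun i => s i z) i)))⁻¹) y :=
    ContMDiffAt.inv₀ (ContDiffAt.comp_contMDiffAt (x := y) (Real.contDiffAt_sqrt hne) (h.inner h))
      (Real.sqrt_ne_zero'.2 (lt_of_le_of_ne real_inner_self_nonneg hne.symm))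
  refine (SmoothAt.smul hn h).congr (Filter.Eventually.of_forall fun z => ?_)
  simp only [Pi.smul_apply', InnerProductSpace.gramSchmidtNormed, norm_eq_sqrt_real_inner]
  rfl

namespace IsOrthonormalFrameOn

variable {e : Fin (Module.finrank ℝ E) → Π x : M, TangentSpace I x} {U : Set M} {x : M}
  {X Y Z : Π x : M, TangentSpace I x}

/-- The orthonormal basis of the tangent space given by an orthonormal frame. -/
def basis (he : IsOrthonormalFrameOn I M e U) (hx : x ∈ U) :
    OrthonormalBasis (Fin (Module.finrank ℝ E)) ℝ (TangentSpace I x) :=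
  OrthonormalBasis.mk (he.orthonormal x hx)
    ((he.orthonormal x hx).linearIndependent.span_eq_top_of_card_eq_finrank'
      (Fintype.card_fin _)).ge

theorem basis_apply (he : IsOrthonormalFrameOn I M e U) (hx : x ∈ U)
    (i : Fin (Module.finrank ℝ E)) : he.basis hx i = e i x := by
  simp [basis]

theorem sum_inner_smul (he : IsOrthonormalFrameOn I M e U) (hx : x ∈ U) (v : TangentSpace I x) :
    ∑ i, (inner ℝ (e i x) v : ℝ) • e i x = v := by
  simpa [basis_apply] using (he.basis hx).sum_repr' v

/-- Near `x` the field is the sum of its components times the smooth frame fields. Fields that are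
only defined pointwise, such as `nabla X Y` and `ricciField X`, are shown to be smooth in this way.
-/
theorem smoothAt_of_inner (he : IsOrthonormalFrameOn I M e U) (hx : x ∈ U)
    (h : ∀ i, CMDiffAt ∞ (fun y => inner ℝ (Y y) (e i y)) x) : SmoothAt Y x := by
  have hs : SmoothAt (fun y => ∑ i, ((fun y => inner ℝ (Y y) (e i y)) • e i) y) x :=
    SmoothAt.sum fun i _ => SmoothAt.smul (h i) (he.smoothAt i x hx)
  refine hs.congr ?_
  filter_upwards [he.isOpen.mem_nhds hx] with y hy
  refine (he.sum_inner_smul hy (Y y)).symm.trans (Finset.sum_congr rfl fun i _ => ?_)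
  rw [real_inner_comm]
  rfl

end IsOrthonormalFrameOn

/-! ### Rules for the covariant derivative. -/

section Nabla

variable {X Y Z W X' Y' Z' : Π x : M, TangentSpace I x} {f g : M → ℝ} {x : M}

theorem inner_nabla (hX : MDiffAt (T% X) x) (hY : MDiffAt (T% Y) x) (hZ : MDiffAt (T% Z) x) :
    inner ℝ (nabla X Y x) (Z x) = koszul X Y Z x :=
  inner_leviCivitaFun hX hY hZ

theorem SmoothAt.nabla (hX : SmoothAt X x) (hY : SmoothAt Y x) : SmoothAt (nabla X Y) x := by
  obtain ⟨e, U, hx, he⟩ := exists_isOrthonormalFrameOn (I := I) x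
  refine he.smoothAt_of_inner hx fun i => ?_
  refine (contMDiffAt_koszul hX hY (he.smoothAt i x hx)).congr_of_eventuallyEq ?_
  filter_upwards [hX.eventually_mdifferentiableAt, hY.eventually_mdifferentiableAt,
    (he.smoothAt i x hx).eventually_mdifferentiableAt] with y h1 h2 h3
  exact inner_nabla h1 h2 h3

theorem nabla_add_right (hY : MDiffAt (T% Y) x) (hZ : MDiffAt (T% Z) x) :
    nabla X (Y + Z) x = nabla X Y x + nabla X Z x := by
  have := isCovariantDerivativeOn_leviCivitaFun.add hY hZ (mem_univ x)
  exact congrArg (fun L => L (X x)) this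

theorem nabla_smul_right (hf : MDiffAt f x) (hY : MDiffAt (T% Y) x) :
    nabla X (f • Y) x = f x • nabla X Y x + mvfderiv I f x (X x) • Y x := by
  have := isCovariantDerivativeOn_leviCivitaFun.leibniz hY hf (mem_univ x)
  exact congrArg (fun L => L (X x)) this

theorem nabla_add_left : nabla (X + Y) Z x = nabla X Z x + nabla Y Z x := by
  simp [nabla]

theorem nabla_smul_left : nabla (f • X) Z x = f x • nabla X Z x := by
  simp [nabla]

theorem nabla_congr_left (h : X x = X' x) : nabla X Z x = nabla X' Z x := by
  simp [nabla, h]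

theorem nabla_neg_right (hY : MDiffAt (T% Y) x) : nabla X (-Y) x = - nabla X Y x := by
  have h := nabla_smul_right (X := X) (f := fun _ : M => (-1 : ℝ)) mdifferentiableAt_const hY
  have h' : (fun _ : M => (-1 : ℝ)) • Y = -Y := by ext y; simp
  rw [h'] at h
  rw [mvfderiv_const] at h
  simpa using h

theorem nabla_sub_right (hY : MDiffAt (T% Y) x) (hZ : MDiffAt (T% Z) x) :
    nabla X (Y - Z) x = nabla X Y x - nabla X Z x := by
  rw [sub_eq_add_neg, nabla_add_right hY (mdifferentiableAt_neg_section hZ), nabla_neg_right hZ,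
    sub_eq_add_neg]

theorem nabla_congr_right (hY : MDiffAt (T% Y) x) (h : Y' =ᶠ[𝓝 x] Y) :
    nabla X Y' x = nabla X Y x := by
  have := isCovariantDerivativeOn_leviCivitaFun.congr_of_eventuallyEq (σ' := Y') hY
    (hY.congr_of_eventuallyEq (by filter_upwards [h] with y hy; rw [hy])) Filter.univ_mem h.symm
  exact (congrArg (fun L => L (X x)) this).symm

theorem nabla_sub_nabla (hX : MDiffAt (T% X) x) (hY : MDiffAt (T% Y) x) :
    nabla X Y x - nabla Y X x = mlieBracket I X Y x :=
  leviCivita_torsion_free hX hY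

theorem mvfderiv_inner (hX : MDiffAt (T% X) x) (hY : MDiffAt (T% Y) x) (hZ : MDiffAt (T% Z) x) :
    mvfderiv I (fun y => inner ℝ (Y y) (Z y)) x (X x)
      = inner ℝ (nabla X Y x) (Z x) + inner ℝ (Y x) (nabla X Z x) :=
  leviCivita_metric hX hY hZ

end Nabla

/-! ### Traces and tensoriality. -/

/-- Traces are defined with `frame I x`, chosen at each point with no regularity in `x`. This allows
a smooth frame in its place, which can be differentiated. -/
theorem sum_bilin_orthonormalBasis {V : Type*} [NormedAddCommGroup V] [InnerProductSpace ℝ V]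
    {ι κ : Type*} [Fintype ι] [Fintype κ] (b : OrthonormalBasis ι ℝ V)
    (b' : OrthonormalBasis κ ℝ V) (B : V →ₗ[ℝ] V →ₗ[ℝ] ℝ) :
    ∑ i, B (b i) (b i) = ∑ j, B (b' j) (b' j) := by
  classical
  have h1 : ∀ i, B (b i) (b i) = ∑ j, ∑ k, inner ℝ (b' j) (b i) * inner ℝ (b' k) (b i) *
      B (b' j) (b' k) := by
    intro i
    conv_lhs => rw [← b'.sum_repr' (b i)]
    simp only [map_sum, LinearMap.sum_apply, map_smul, LinearMap.smul_apply, smul_eq_mul,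
      Finset.mul_sum]
    rw [Finset.sum_comm]
    exact Finset.sum_congr rfl fun j _ => Finset.sum_congr rfl fun k _ => by ring
  have h2 : ∀ j k, ∑ i, inner ℝ (b' j) (b i) * inner ℝ (b' k) (b i) =
      if j = k then (1 : ℝ) else 0 := by
    intro j k
    rw [← orthonormal_iff_ite.1 b'.orthonormal j k, ← b.sum_inner_mul_inner]
    exact Finset.sum_congr rfl fun i _ => by rw [real_inner_comm (b i) (b' k)]
  simp_rw [h1]
  rw [Finset.sum_comm]
  refine Finset.sum_congr rfl fun j _ => ?_
  rw [Finset.sum_comm]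
  simp_rw [← Finset.sum_mul, h2]
  simp

section Tensorial

variable {A : Type*} [AddCommGroup A] [Module ℝ A] {x : M}

/-- A local operation on smooth vector fields that is additive and homogeneous over smooth functions
depends only on the value of the vector field at the point. -/
theorem eq_of_smooth_tensorial {Φ : (Π x : M, TangentSpace I x) → A}
    (hcongr : ∀ X X' : Π x : M, TangentSpace I x, SmoothAt X x → X' =ᶠ[𝓝 x] X → Φ X' = Φ X)
    (hadd : ∀ X X' : Π x : M, TangentSpace I x, SmoothAt X x → SmoothAt X' x →
      Φ (X + X') = Φ X + Φ X')
    (hsmul : ∀ (f : M → ℝ) (X : Π x : M, TangentSpace I x), CMDiffAt ∞ f x → SmoothAt X x →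
      Φ (f • X) = f x • Φ X)
    {X X' : Π x : M, TangentSpace I x} (hX : SmoothAt X x) (hX' : SmoothAt X' x)
    (h : X x = X' x) : Φ X = Φ X' := by
  classical
  obtain ⟨e, U, hx, he⟩ := exists_isOrthonormalFrameOn (I := I) x
  -- Expanding in a smooth frame and applying linearity over functions leaves only the components at
  -- `x`.
  have key : ∀ X : Π x : M, TangentSpace I x, SmoothAt X x →
      Φ X = ∑ i, (inner ℝ (e i x) (X x) : ℝ) • Φ (e i) := by
    intro X hX
    have hterm : ∀ i, SmoothAt ((fun y => inner ℝ (e i y) (X y)) • e i) x := fun i =>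
      SmoothAt.smul ((he.smoothAt i x hx).inner hX) (he.smoothAt i x hx)
    have hsum : ∀ s : Finset (Fin (Module.finrank ℝ E)),
        Φ (fun y => ∑ i ∈ s, ((fun y => inner ℝ (e i y) (X y)) • e i) y)
          = ∑ i ∈ s, (inner ℝ (e i x) (X x) : ℝ) • Φ (e i) := by
      intro s
      induction s using Finset.induction_on with
      | empty =>
        -- Homogeneity with the zero function gives Φ 0 = 0.
        have h0 := hsmul (fun _ => 0) X contMDiffAt_const hX
        rw [zero_smul] at h0
        rw [Finset.sum_empty, ← h0]
        congr 1
        ext y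
        simp
      | insert i s hi ih =>
        rw [Finset.sum_insert hi, ← ih,
          ← hsmul (fun y => inner ℝ (e i y) (X y)) (e i) ((he.smoothAt i x hx).inner hX)
            (he.smoothAt i x hx), ← hadd _ _ (hterm i) (SmoothAt.sum fun j _ => hterm j)]
        congr 1
        ext y
        simp [Finset.sum_insert hi]
    rw [← hsum]
    refine (hcongr _ _ hX ?_).symm
    filter_upwards [he.isOpen.mem_nhds hx] with y hy
    exact he.sum_inner_smul hy (X y)
  rw [key X hX, key X' hX', h]

end Tensorial

/-! ### Tensoriality of the curvature. -/

section Curvature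

variable {X Y Z W X' Y' Z' : Π x : M, TangentSpace I x} {f : M → ℝ} {x : M}

theorem curvature_apply : curvature X Y Z x = nabla X (nabla Y Z) x - nabla Y (nabla X Z) x
    - nabla (mlieBracket I X Y) Z x := rfl

theorem SmoothAt.curvature (hX : SmoothAt X x) (hY : SmoothAt Y x) (hZ : SmoothAt Z x) :
    SmoothAt (curvature X Y Z) x :=
  ((hX.nabla (hY.nabla hZ)).sub (hY.nabla (hX.nabla hZ))).sub ((hX.mlieBracket hY).nabla hZ)

theorem nabla_eventuallyEq (hY : SmoothAt Y x) (h : X' =ᶠ[𝓝 x] X) (h' : Y' =ᶠ[𝓝 x] Y) :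
    nabla X' Y' =ᶠ[𝓝 x] nabla X Y := by
  filter_upwards [h, h'.eventually_nhds, hY.eventually_mdifferentiableAt] with y h1 h2 h3
  rw [nabla_congr_left h1, nabla_congr_right h3 h2]

theorem curvature_congr (hX : SmoothAt X x) (hY : SmoothAt Y x) (hZ : SmoothAt Z x)
    (h1 : X' =ᶠ[𝓝 x] X) (h2 : Y' =ᶠ[𝓝 x] Y) (h3 : Z' =ᶠ[𝓝 x] Z) :
    curvature X' Y' Z' x = curvature X Y Z x := by
  rw [curvature_apply, curvature_apply,
    (nabla_eventuallyEq (hY.nabla hZ) h1 (nabla_eventuallyEq hZ h2 h3)).self_of_nhds,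
    (nabla_eventuallyEq (hX.nabla hZ) h2 (nabla_eventuallyEq hZ h1 h3)).self_of_nhds,
    nabla_congr_left (h1.mlieBracket_vectorField_eq h2), nabla_congr_right hZ.mdifferentiableAt h3]

theorem curvature_swap : curvature Y X Z x = - curvature X Y Z x := by
  have h : mlieBracket I Y X x = (-mlieBracket I X Y) x := mlieBracket_swap_apply
  have h' : nabla (-mlieBracket I X Y) Z x = - nabla (mlieBracket I X Y) Z x := by simp [nabla]
  rw [curvature_apply, curvature_apply, nabla_congr_left h, h']
  abel

theorem curvature_add_left (hX : SmoothAt X x) (hX' : SmoothAt X' x) (hZ : SmoothAt Z x) : curvature (X + X') Y Z x = curvature X Y Z x + curvature X' Y Z x := by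
  have : CompleteSpace E := FiniteDimensional.complete ℝ E
  have h1 : nabla (X + X') Z = nabla X Z + nabla X' Z := by ext1 y; exact nabla_add_left
  have h2 : mlieBracket I (X + X') Y x = (mlieBracket I X Y + mlieBracket I X' Y) x :=
    mlieBracket_add_left hX.mdifferentiableAt hX'.mdifferentiableAt
  simp only [curvature_apply]
  rw [h1, nabla_congr_left h2, nabla_add_left, nabla_add_left,
    nabla_add_right (hX.nabla hZ).mdifferentiableAt (hX'.nabla hZ).mdifferentiableAt]
  abel

theorem curvature_smul_left (hf : CMDiffAt ∞ f x) (hX : SmoothAt X x) (hZ : SmoothAt Z x) : curvature (f • X) Y Z x = f x • curvature X Y Z x := by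
  have : CompleteSpace E := FiniteDimensional.complete ℝ E
  have hf' : MDiffAt f x := hf.mdifferentiableAt (by simp)
  have h1 : nabla (f • X) Z = f • nabla X Z := by ext1 y; exact nabla_smul_left
  have h2 : mlieBracket I (f • X) Y x =
      ((fun y => - mvfderiv I f y (Y y)) • X + f • mlieBracket I X Y) x :=
    mlieBracket_smul_left hf' hX.mdifferentiableAt
  simp only [curvature_apply]
  rw [h1, nabla_congr_left h2, nabla_add_left, nabla_smul_left, nabla_smul_left, nabla_smul_left,
    nabla_smul_right hf' (hX.nabla hZ).mdifferentiableAt]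
  module

theorem nabla_add_right_eventuallyEq (hY : SmoothAt Y x) (hZ : SmoothAt Z x) :
    nabla X (Y + Z) =ᶠ[𝓝 x] nabla X Y + nabla X Z := by
  filter_upwards [hY.eventually_mdifferentiableAt, hZ.eventually_mdifferentiableAt] with y h1 h2
  exact nabla_add_right h1 h2

theorem eventually_mdifferentiableAt_of_contMDiffAt (hf : CMDiffAt ∞ f x) :
    ∀ᶠ y in 𝓝 x, MDiffAt f y := by
  have h : CMDiffAt 1 f x := hf.of_le (by exact_mod_cast le_top)
  filter_upwards [(contMDiffAt_iff_contMDiffAt_nhds (by simp)).1 h] with y hy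
  exact hy.mdifferentiableAt one_ne_zero

theorem curvature_add_right (hX : SmoothAt X x) (hY : SmoothAt Y x) (hZ : SmoothAt Z x)
    (hZ' : SmoothAt Z' x) : curvature X Y (Z + Z') x = curvature X Y Z x + curvature X Y Z' x := by
  simp only [curvature_apply]
  rw [nabla_congr_right ((hY.nabla hZ).add (hY.nabla hZ')).mdifferentiableAt
      (nabla_add_right_eventuallyEq hZ hZ'),
    nabla_congr_right ((hX.nabla hZ).add (hX.nabla hZ')).mdifferentiableAt
      (nabla_add_right_eventuallyEq hZ hZ'),
    nabla_add_right (hY.nabla hZ).mdifferentiableAt (hY.nabla hZ').mdifferentiableAt,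
    nabla_add_right (hX.nabla hZ).mdifferentiableAt (hX.nabla hZ').mdifferentiableAt,
    nabla_add_right hZ.mdifferentiableAt hZ'.mdifferentiableAt]
  abel

/-- The Jacobi identity in Leibniz form. -/
theorem mlieBracket_jacobi (hX : SmoothAt X x) (hY : SmoothAt Y x) (hZ : SmoothAt Z x) :
    VectorField.mlieBracket I X (VectorField.mlieBracket I Y Z) x =
      VectorField.mlieBracket I (VectorField.mlieBracket I X Y) Z x
        + VectorField.mlieBracket I Y (VectorField.mlieBracket I X Z) x := by
  have : CompleteSpace E := FiniteDimensional.complete ℝ E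
  have : IsManifold I (minSmoothness ℝ 3) M := by
    simp only [minSmoothness_of_isRCLikeNormedField]; infer_instance
  have h2 : minSmoothness ℝ 2 ≤ ∞ := by
    simp only [minSmoothness_of_isRCLikeNormedField]; exact ENat.LEInfty.out
  exact leibniz_identity_mlieBracket_apply (ContMDiffAt.of_le hX h2) (ContMDiffAt.of_le hY h2)
    (ContMDiffAt.of_le hZ h2)

/-- The Lie bracket of vector fields is the commutator of derivations. -/
theorem mvfderiv_mlieBracket (hf : CMDiffAt ∞ f x) (hX : SmoothAt X x) (hY : SmoothAt Y x) :
    mvfderiv I f x (mlieBracket I X Y x) =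
      mvfderiv I (fun y => mvfderiv I f y (Y y)) x (X x) -
        mvfderiv I (fun y => mvfderiv I f y (X y)) x (Y x) := by
  have : CompleteSpace E := FiniteDimensional.complete ℝ E
  -- The argument below needs a field that is nonzero at `x`. On a zero tangent space the identity
  -- is trivial.
  by_cases hv : ∀ v : TangentSpace I x, v = 0
  · rw [hv (X x), hv (Y x), hv (VectorField.mlieBracket I X Y x)]
    simp
  push Not at hv
  obtain ⟨v, hv⟩ := hv
  -- The commutator formula is read off from the Jacobi identity for X, Y, fZ. After the Leibniz
  -- rule and the Jacobi identity for X, Y, Z, what remains is ([X,Y]f - X(Yf) + Y(Xf)) Z = 0.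
  set Z : Π x : M, TangentSpace I x := extend E v with hZdef
  have hZ : SmoothAt Z x := smoothAt_extend v
  have hZv : Z x = v := extend_apply_self E v
  have key : ∀ V : Π x : M, TangentSpace I x,
      VectorField.mlieBracket I V (f • Z) =ᶠ[𝓝 x]
        (fun y => mvfderiv I f y (V y)) • Z + f • VectorField.mlieBracket I V Z := by
    intro V
    filter_upwards [hZ.eventually_mdifferentiableAt,
      eventually_mdifferentiableAt_of_contMDiffAt hf] with y h1 h2
    exact mlieBracket_smul_right h2 h1
  have hf' : MDiffAt f x := hf.mdifferentiableAt (by simp)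
  have hs : ∀ V : Π x : M, TangentSpace I x, SmoothAt V x → CMDiffAt ∞
      (fun y => mvfderiv I f y (V y)) x := fun V hV => SmoothAt.mvfderiv_apply hf hV
  have hs' : ∀ V : Π x : M, TangentSpace I x, SmoothAt V x → MDiffAt
      (fun y => mvfderiv I f y (V y)) x := fun V hV => (hs V hV).mdifferentiableAt (by simp)
  have key2 : ∀ V V' : Π x : M, TangentSpace I x, SmoothAt V x →
      VectorField.mlieBracket I V' (VectorField.mlieBracket I V (f • Z)) x
        = (mvfderiv I (fun y => mvfderiv I f y (V y)) x (V' x) • Z x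
          + mvfderiv I f x (V x) • VectorField.mlieBracket I V' Z x)
        + (mvfderiv I f x (V' x) • VectorField.mlieBracket I V Z x
          + f x • VectorField.mlieBracket I V' (VectorField.mlieBracket I V Z) x) := by
    intro V V' hV
    have h1 := SmoothAt.smul hf (hV.mlieBracket hZ)
    have h2 := SmoothAt.smul (hs V hV) hZ
    rw [Filter.EventuallyEq.mlieBracket_vectorField_eq (V₁ := V') .rfl (key V),
      mlieBracket_add_right h2.mdifferentiableAt h1.mdifferentiableAt,
      mlieBracket_smul_right hf' (hV.mlieBracket hZ).mdifferentiableAt,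
      mlieBracket_smul_right (hs' V hV) hZ.mdifferentiableAt]
  have hfZ := SmoothAt.smul hf hZ
  have e1 := mlieBracket_jacobi hX hY hfZ
  have e2 := mlieBracket_jacobi hX hY hZ
  rw [key2 Y X hY, key2 X Y hX, (key _).self_of_nhds] at e1
  simp only [Pi.add_apply, Pi.smul_apply'] at e1
  rw [e2] at e1
  have e3 : (mvfderiv I f x (VectorField.mlieBracket I X Y x) -
      (mvfderiv I (fun y => mvfderiv I f y (Y y)) x (X x) -
        mvfderiv I (fun y => mvfderiv I f y (X y)) x (Y x))) • Z x = 0 := by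
    rw [← sub_eq_zero.2 e1.symm]
    module
  rw [hZv, smul_eq_zero] at e3
  exact sub_eq_zero.1 (e3.resolve_right hv)

/-- The first-order terms in f cancel by symmetry. The second derivatives combine with the bracket
term and vanish by `mvfderiv_mlieBracket`. -/
theorem curvature_smul_right (hf : CMDiffAt ∞ f x) (hX : SmoothAt X x) (hY : SmoothAt Y x)
    (hZ : SmoothAt Z x) : curvature X Y (f • Z) x = f x • curvature X Y Z x := by
  have hf' : MDiffAt f x := hf.mdifferentiableAt (by simp)
  have key : ∀ V : Π x : M, TangentSpace I x,
      nabla V (f • Z) =ᶠ[𝓝 x] f • nabla V Z + (fun y => mvfderiv I f y (V y)) • Z := by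
    intro V
    filter_upwards [hZ.eventually_mdifferentiableAt,
      eventually_mdifferentiableAt_of_contMDiffAt hf] with y h1 h2
    exact nabla_smul_right h2 h1
  have hs : ∀ V : Π x : M, TangentSpace I x, SmoothAt V x → CMDiffAt ∞
      (fun y => mvfderiv I f y (V y)) x := fun V hV => SmoothAt.mvfderiv_apply hf hV
  have hs' : ∀ V : Π x : M, TangentSpace I x, SmoothAt V x → MDiffAt
      (fun y => mvfderiv I f y (V y)) x := fun V hV => (hs V hV).mdifferentiableAt (by simp)
  have key2 : ∀ V V' : Π x : M, TangentSpace I x, SmoothAt V x →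
      nabla V' (nabla V (f • Z)) x = f x • nabla V' (nabla V Z) x
        + mvfderiv I f x (V' x) • nabla V Z x + (mvfderiv I f x (V x) • nabla V' Z x
        + mvfderiv I (fun y => mvfderiv I f y (V y)) x (V' x) • Z x) := by
    intro V V' hV
    have h1 := SmoothAt.smul hf (hV.nabla hZ)
    have h2 := SmoothAt.smul (hs V hV) hZ
    rw [nabla_congr_right (h1.add h2).mdifferentiableAt (key V),
      nabla_add_right h1.mdifferentiableAt h2.mdifferentiableAt,
      nabla_smul_right hf' (hV.nabla hZ).mdifferentiableAt,
      nabla_smul_right (hs' V hV) hZ.mdifferentiableAt]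
  simp only [curvature_apply]
  rw [key2 Y X hY, key2 X Y hX, nabla_smul_right hf' hZ.mdifferentiableAt,
    mvfderiv_mlieBracket hf hX hY]
  module

/-- This frees the Ricci tensor from the particular extensions in its definition. The second slot is
reduced to the first by antisymmetry. -/
theorem curvature_eq_of_eq (hX : SmoothAt X x) (hX' : SmoothAt X' x) (hY : SmoothAt Y x)
    (hY' : SmoothAt Y' x) (hZ : SmoothAt Z x) (hZ' : SmoothAt Z' x)
    (h1 : X x = X' x) (h2 : Y x = Y' x) (h3 : Z x = Z' x) :
    curvature X Y Z x = curvature X' Y' Z' x := by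
  have left : ∀ {X X' Y Z : Π x : M, TangentSpace I x}, SmoothAt X x → SmoothAt X' x →
      SmoothAt Y x → SmoothAt Z x → X x = X' x → curvature X Y Z x = curvature X' Y Z x := by
    intro X X' Y Z hX hX' hY hZ h
    exact eq_of_smooth_tensorial (Φ := fun X => curvature X Y Z x)
      (fun V V' hV hVV' => curvature_congr hV hY hZ hVV' .rfl .rfl)
      (fun V V' hV hV' => curvature_add_left hV hV' hZ)
      (fun f V hf hV => curvature_smul_left hf hV hZ) hX hX' h
  rw [left hX hX' hY hZ h1, ← neg_inj, ← curvature_swap, ← curvature_swap, left hY hY' hX' hZ h2]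
  exact eq_of_smooth_tensorial (Φ := fun Z => curvature Y' X' Z x)
      (fun V V' hV hVV' => curvature_congr hY' hX' hV .rfl .rfl hVV')
      (fun V V' hV hV' => curvature_add_right hY' hX' hV hV')
      (fun f V hf hV => curvature_smul_right hf hY' hX' hV) hZ hZ' h3

end Curvature

/-! ### Ricci and scalar curvature in a smooth frame. -/

/-- The Riemann tensor `g(R(X, Y) Z, W)`. -/
def riemann (X Y Z W : Π x : M, TangentSpace I x) (x : M) : ℝ :=
  inner ℝ (curvature X Y Z x) (W x)

section Ricci

variable {X Y Z W X' Y' Z' : Π x : M, TangentSpace I x} {f : M → ℝ} {x : M}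

theorem contMDiffAt_riemann (hX : SmoothAt X x) (hY : SmoothAt Y x) (hZ : SmoothAt Z x)
    (hW : SmoothAt W x) : CMDiffAt ∞ (riemann X Y Z W) x :=
  (hX.curvature hY hZ).inner hW

theorem curvature_add_middle (hY : SmoothAt Y x) (hY' : SmoothAt Y' x)
    (hZ : SmoothAt Z x) : curvature X (Y + Y') Z x = curvature X Y Z x + curvature X Y' Z x := by
  rw [← neg_inj, neg_add, ← curvature_swap, ← curvature_swap, ← curvature_swap,
    curvature_add_left hY hY' hZ]

theorem curvature_smul_middle (hf : CMDiffAt ∞ f x) (hY : SmoothAt Y x) (hZ : SmoothAt Z x) :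
    curvature X (f • Y) Z x = f x • curvature X Y Z x := by
  rw [← neg_inj, ← smul_neg, ← curvature_swap, ← curvature_swap, curvature_smul_left hf hY hZ]

theorem smoothAt_const_smul_extend (c : ℝ) (v : TangentSpace I x) :
    SmoothAt ((fun _ : M => c) • extend E v) x :=
  SmoothAt.smul contMDiffAt_const (smoothAt_extend v)

/-- The bilinear form `(v, w) ↦ g(R(v, Y) Z, w)` on the tangent space at `x`. -/
def curvatureForm (hY : SmoothAt Y x) (hZ : SmoothAt Z x) :
    TangentSpace I x →ₗ[ℝ] TangentSpace I x →ₗ[ℝ] ℝ :=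
  LinearMap.mk₂ ℝ (fun v w => inner ℝ (curvature (extend E v) Y Z x) w)
    (fun v v' w => by
      rw [← inner_add_left, ← curvature_add_left (smoothAt_extend v) (smoothAt_extend v') hZ]
      congr 1
      exact curvature_eq_of_eq (smoothAt_extend _) ((smoothAt_extend v).add (smoothAt_extend v'))
        hY hY hZ hZ (by simp) rfl rfl)
    (fun c v w => by
      have h := curvature_smul_left (Y := Y) (f := fun _ : M => c) contMDiffAt_const
        (smoothAt_extend v) hZ
      rw [smul_eq_mul, ← real_inner_smul_left, ← h]
      congr 1
      exact curvature_eq_of_eq (smoothAt_extend _) (smoothAt_const_smul_extend c v)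
        hY hY hZ hZ (by simp) rfl rfl)
    (fun v w w' => inner_add_right _ _ _)
    (fun c v w => real_inner_smul_right _ _ _)

theorem curvatureForm_apply (hY : SmoothAt Y x) (hZ : SmoothAt Z x) (hX : SmoothAt X x) :
    curvatureForm hY hZ (X x) (W x) = riemann X Y Z W x := by
  simp only [curvatureForm, LinearMap.mk₂_apply, riemann]
  congr 1
  exact curvature_eq_of_eq (smoothAt_extend _) hX hY hY hZ hZ (by simp) rfl rfl

/-- Independence of basis and of extension together replace the pointwise definition by an
expression smooth in the point. -/
theorem IsOrthonormalFrameOn.ricci_eq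
    {e : Fin (Module.finrank ℝ E) → Π x : M, TangentSpace I x} {U : Set M}
    (he : IsOrthonormalFrameOn I M e U) (hx : x ∈ U) (hY : SmoothAt Y x) (hZ : SmoothAt Z x) :
    ricci x (Y x) (Z x) = ∑ i, riemann (e i) Y Z (e i) x := by
  have h := sum_bilin_orthonormalBasis (frame I x) (he.basis hx) (curvatureForm hY hZ)
  refine Eq.trans (Finset.sum_congr rfl fun i _ => ?_) (h.trans (Finset.sum_congr rfl fun i _ => ?_))
  · simp only [curvatureForm, LinearMap.mk₂_apply]
    congr 1
    exact curvature_eq_of_eq (smoothAt_extend _) (smoothAt_extend _) (smoothAt_extend _) hY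
      (smoothAt_extend _) hZ rfl (by simp) (by simp)
  · rw [he.basis_apply, curvatureForm_apply hY hZ (he.smoothAt i x hx)]

variable (x) in
/-- The Ricci tensor at a point as a bilinear form. -/
def ricciForm : TangentSpace I x →ₗ[ℝ] TangentSpace I x →ₗ[ℝ] ℝ :=
  LinearMap.mk₂ ℝ (ricci x)
    (fun u u' v => by
      have hs := fun w : TangentSpace I x => smoothAt_extend (E := E) w
      simp only [ricci]
      rw [← Finset.sum_add_distrib]
      refine Finset.sum_congr rfl fun i _ => ?_
      rw [← inner_add_left, ← curvature_add_middle (hs u) (hs u') (hs v),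
        curvature_eq_of_eq (hs _) (hs _) (hs (u + u')) ((hs u).add (hs u')) (hs v) (hs v) rfl
          (by simp) rfl])
    (fun c u v => by
      have hs := fun w : TangentSpace I x => smoothAt_extend (E := E) w
      simp only [ricci, smul_eq_mul]
      rw [Finset.mul_sum]
      refine Finset.sum_congr rfl fun i _ => ?_
      have h := curvature_smul_middle (X := extend E (frame I x i)) (f := fun _ : M => c)
        contMDiffAt_const (hs u) (hs v)
      rw [← real_inner_smul_left, ← h, curvature_eq_of_eq (hs _) (hs _) (hs (c • u))
        (smoothAt_const_smul_extend c u) (hs v) (hs v) rfl (by simp) rfl])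
    (fun u v v' => by
      have hs := fun w : TangentSpace I x => smoothAt_extend (E := E) w
      simp only [ricci]
      rw [← Finset.sum_add_distrib]
      refine Finset.sum_congr rfl fun i _ => ?_
      rw [← inner_add_left, ← curvature_add_right (hs _) (hs u) (hs v) (hs v'),
        curvature_eq_of_eq (hs _) (hs _) (hs u) (hs u) (hs (v + v')) ((hs v).add (hs v')) rfl rfl
          (by simp)])
    (fun c u v => by
      have hs := fun w : TangentSpace I x => smoothAt_extend (E := E) w
      simp only [ricci, smul_eq_mul]
      rw [Finset.mul_sum]
      refine Finset.sum_congr rfl fun i _ => ?_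
      have h := curvature_smul_right (f := fun _ : M => c) contMDiffAt_const
        (hs (frame I x i)) (hs u) (hs v)
      rw [← real_inner_smul_left, ← h, curvature_eq_of_eq (hs _) (hs _) (hs u) (hs u) (hs (c • v))
        (smoothAt_const_smul_extend c v) rfl rfl (by simp)])

theorem ricciForm_apply (u v : TangentSpace I x) : ricciForm x u v = ricci x u v := rfl

theorem scalarCurvature_eq_sum_ricci {ι : Type*} [Fintype ι]
    (b : OrthonormalBasis ι ℝ (TangentSpace I x)) :
    scalarCurvature I x = ∑ i, ricci x (b i) (b i) :=
  sum_bilin_orthonormalBasis (frame I x) b (ricciForm x)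

theorem contMDiffAt_ricci (hY : SmoothAt Y x) (hZ : SmoothAt Z x)
    (hY' : ∀ᶠ y in 𝓝 x, SmoothAt Y y) (hZ' : ∀ᶠ y in 𝓝 x, SmoothAt Z y) :
    CMDiffAt ∞ (fun y => ricci y (Y y) (Z y)) x := by
  obtain ⟨e, U, hx, he⟩ := exists_isOrthonormalFrameOn (I := I) x
  have hs : CMDiffAt ∞ (fun y => ∑ i, riemann (e i) Y Z (e i) y) x :=
    ContMDiffAt.sum fun i _ => contMDiffAt_riemann (he.smoothAt i x hx) hY hZ (he.smoothAt i x hx)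
  refine hs.congr_of_eventuallyEq ?_
  filter_upwards [he.isOpen.mem_nhds hx, hY', hZ'] with y hy h1 h2
  exact he.ricci_eq hy h1 h2

theorem contMDiff_scalarCurvature : CMDiff ∞ (scalarCurvature I : M → ℝ) := by
  intro x
  obtain ⟨e, U, hx, he⟩ := exists_isOrthonormalFrameOn (I := I) x
  have hs : CMDiffAt ∞ (fun y => ∑ i, ricci y (e i y) (e i y)) x :=
    ContMDiffAt.sum fun i _ => by
      have h : ∀ᶠ y in 𝓝 x, SmoothAt (e i) y := by
        filter_upwards [he.isOpen.mem_nhds hx] with y hy using he.smoothAt i y hy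
      exact contMDiffAt_ricci (he.smoothAt i x hx) (he.smoothAt i x hx) h h
  refine hs.congr_of_eventuallyEq ?_
  filter_upwards [he.isOpen.mem_nhds hx] with y hy
  rw [scalarCurvature_eq_sum_ricci (he.basis hy)]
  simp only [he.basis_apply]

end Ricci

/-! ### Symmetries of the curvature and the Bianchi identities. -/

/-- Infinitesimal form of the basis independence of a trace: `hn` says that `n` has a skew matrix in
the basis `b`, as the velocity of a moving orthonormal basis does, and the coefficient of each B(b
j, b i) is then a sum of opposite entries. -/
theorem sum_bilin_add_bilin_eq_zero {V : Type*} [NormedAddCommGroup V] [InnerProductSpace ℝ V]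
    {ι : Type*} [Fintype ι] (b : OrthonormalBasis ι ℝ V) (B : V →ₗ[ℝ] V →ₗ[ℝ] ℝ) {n : ι → V}
    (hn : ∀ i j, inner ℝ (n i) (b j) + inner ℝ (b i) (n j) = (0 : ℝ)) :
    ∑ i, (B (n i) (b i) + B (b i) (n i)) = 0 := by
  have h1 : ∀ i, B (n i) (b i) = ∑ j, inner ℝ (b j) (n i) * B (b j) (b i) := by
    intro i
    conv_lhs => rw [← b.sum_repr' (n i)]
    simp
  have h2 : ∀ i, B (b i) (n i) = ∑ j, inner ℝ (b j) (n i) * B (b i) (b j) := by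
    intro i
    conv_lhs => rw [← b.sum_repr' (n i)]
    simp
  simp_rw [h1, h2]
  rw [Finset.sum_add_distrib]
  conv_lhs => enter [2]; rw [Finset.sum_comm]
  rw [← Finset.sum_add_distrib]
  refine Finset.sum_eq_zero fun i _ => ?_
  rw [← Finset.sum_add_distrib]
  refine Finset.sum_eq_zero fun j _ => ?_
  rw [← add_mul, real_inner_comm (n i) (b j), hn i j, zero_mul]

section Bianchi

variable {X Y Z W T : Π x : M, TangentSpace I x} {f : M → ℝ} {x : M}

theorem mvfderiv_congr {g : M → ℝ} (h : f =ᶠ[𝓝 x] g) : mvfderiv I f x = mvfderiv I g x := by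
  ext v
  exact congrArg (fun L : E →L[ℝ] ℝ => L v) (h.mfderiv_eq (I := I) (I' := 𝓘(ℝ, ℝ)))

theorem riemann_swap_left : riemann Y X Z W x = - riemann X Y Z W x := by
  rw [riemann, riemann, curvature_swap, inner_neg_left]

/-- Differentiate ⟨Z, W⟩ twice and compare with its derivative along [X,Y]. The mixed terms ⟨∇Z, ∇W⟩
are symmetric in X, Y and cancel, leaving ⟨R(X,Y)Z, W⟩ + ⟨Z, R(X,Y)W⟩ = 0. -/
theorem riemann_swap_right (hX : SmoothAt X x) (hY : SmoothAt Y x) (hZ : SmoothAt Z x)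
    (hW : SmoothAt W x) : riemann X Y W Z x = - riemann X Y Z W x := by
  have hd : ∀ {V : Π x : M, TangentSpace I x}, SmoothAt V x →
      (fun y => mvfderiv I (fun y => inner ℝ (Z y) (W y)) y (V y)) =ᶠ[𝓝 x]
        (fun y => inner ℝ (nabla V Z y) (W y)) + fun y => inner ℝ (Z y) (nabla V W y) := by
    intro V hV
    filter_upwards [hV.eventually_mdifferentiableAt, hZ.eventually_mdifferentiableAt,
      hW.eventually_mdifferentiableAt] with y h1 h2 h3
    exact mvfderiv_inner h1 h2 h3
  have hdd : ∀ {V V' : Π x : M, TangentSpace I x}, SmoothAt V x → SmoothAt V' x →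
      mvfderiv I (fun y => mvfderiv I (fun y => inner ℝ (Z y) (W y)) y (V y)) x (V' x) =
        inner ℝ (nabla V' (nabla V Z) x) (W x) + inner ℝ (nabla V Z x) (nabla V' W x)
        + (inner ℝ (nabla V' Z x) (nabla V W x) + inner ℝ (Z x) (nabla V' (nabla V W) x)) := by
    intro V V' hV hV'
    have e : mvfderiv I (fun y => mvfderiv I (fun y => inner ℝ (Z y) (W y)) y (V y)) x =
        mvfderiv I ((fun y => inner ℝ (nabla V Z y) (W y)) +
          fun y => inner ℝ (Z y) (nabla V W y)) x := mvfderiv_congr (hd hV)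
    rw [e, mvfderiv_add (((hV.nabla hZ).inner hW).mdifferentiableAt (by simp))
      ((hZ.inner (hV.nabla hW)).mdifferentiableAt (by simp)), add_apply,
      mvfderiv_inner hV'.mdifferentiableAt (hV.nabla hZ).mdifferentiableAt hW.mdifferentiableAt,
      mvfderiv_inner hV'.mdifferentiableAt hZ.mdifferentiableAt (hV.nabla hW).mdifferentiableAt]
  have h := mvfderiv_mlieBracket (hZ.inner hW) hX hY
  rw [mvfderiv_inner (hX.mlieBracket hY).mdifferentiableAt hZ.mdifferentiableAt
    hW.mdifferentiableAt, hdd hY hX, hdd hX hY] at h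
  simp only [riemann, curvature_apply, inner_sub_left]
  rw [real_inner_comm (Z x), real_inner_comm (Z x), real_inner_comm (Z x)]
  linarith

/-- The vector `(∇_X R)(Y, Z) W` at `x`. -/
def nablaCurvature (X Y Z W : Π x : M, TangentSpace I x) (x : M) : TangentSpace I x :=
  nabla X (curvature Y Z W) x - curvature (nabla X Y) Z W x - curvature Y (nabla X Z) W x
    - curvature Y Z (nabla X W) x

/-- The covariant derivative `(∇_X Rm)(Y, Z, W, T)` of the Riemann tensor. -/
def nablaRiemann (X Y Z W T : Π x : M, TangentSpace I x) (x : M) : ℝ :=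
  mvfderiv I (riemann Y Z W T) x (X x) - riemann (nabla X Y) Z W T x
    - riemann Y (nabla X Z) W T x - riemann Y Z (nabla X W) T x - riemann Y Z W (nabla X T) x

theorem nablaRiemann_eq_inner (hX : SmoothAt X x) (hY : SmoothAt Y x) (hZ : SmoothAt Z x)
    (hW : SmoothAt W x) (hT : SmoothAt T x) :
    nablaRiemann X Y Z W T x = inner ℝ (nablaCurvature X Y Z W x) (T x) := by
  have h := mvfderiv_inner hX.mdifferentiableAt (hY.curvature hZ hW).mdifferentiableAt
    hT.mdifferentiableAt
  have h' : riemann Y Z W T = fun y => inner ℝ (curvature Y Z W y) (T y) := rfl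
  rw [nablaRiemann, h', h, nablaCurvature]
  simp only [riemann, inner_sub_left]
  ring

theorem nabla_curvature_eq (hY : SmoothAt Y x) (hZ : SmoothAt Z x)
    (hW : SmoothAt W x) : nabla X (curvature Y Z W) x = nabla X (nabla Y (nabla Z W)) x
      - nabla X (nabla Z (nabla Y W)) x - nabla X (nabla (mlieBracket I Y Z) W) x := by
  have h1 := hY.nabla (hZ.nabla hW)
  have h2 := hZ.nabla (hY.nabla hW)
  have h3 := (hY.mlieBracket hZ).nabla hW
  have h : curvature Y Z W = nabla Y (nabla Z W) - nabla Z (nabla Y W)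
    - nabla (mlieBracket I Y Z) W := rfl
  rw [h, nabla_sub_right (h1.sub h2).mdifferentiableAt h3.mdifferentiableAt,
    nabla_sub_right h1.mdifferentiableAt h2.mdifferentiableAt]

/-- Torsion-freeness inside the first slot. In the cyclic sum it turns the six correction terms of
∇R into three bracket terms. -/
theorem curvature_nabla_sub_curvature_nabla (hX : SmoothAt X x) (hY : SmoothAt Y x)
    (hZ : SmoothAt Z x) (hW : SmoothAt W x) :
    curvature (nabla X Y) Z W x - curvature (nabla Y X) Z W x =
      curvature (mlieBracket I X Y) Z W x := by
  have h := curvature_add_left (Y := Z) (hY.nabla hX) (hX.mlieBracket hY) hW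
  have h' : curvature (nabla X Y) Z W x = curvature (nabla Y X + mlieBracket I X Y) Z W x :=
    curvature_eq_of_eq (hX.nabla hY) ((hY.nabla hX).add (hX.mlieBracket hY)) hZ hZ hW hW
      (by simp [← nabla_sub_nabla hX.mdifferentiableAt hY.mdifferentiableAt]) rfl rfl
  rw [h', h]
  abel

/-- The second Bianchi identity. -/
theorem nablaCurvature_cyclic (hX : SmoothAt X x) (hY : SmoothAt Y x) (hZ : SmoothAt Z x)
    (hW : SmoothAt W x) :
    nablaCurvature X Y Z W x + nablaCurvature Y Z X W x + nablaCurvature Z X Y W x = 0 := by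
  have e1 := curvature_nabla_sub_curvature_nabla hX hY hZ hW
  have e2 := curvature_nabla_sub_curvature_nabla hY hZ hX hW
  have e3 := curvature_nabla_sub_curvature_nabla hZ hX hY hW
  have s2 : curvature Y (nabla X Z) W x = - curvature (nabla X Z) Y W x := curvature_swap
  have s3 : curvature Z (nabla Y X) W x = - curvature (nabla Y X) Z W x := curvature_swap
  have s4 : curvature X (nabla Z Y) W x = - curvature (nabla Z Y) X W x := curvature_swap
  -- The derivatives of W along iterated brackets cancel by the Jacobi identity. The other terms are
  -- iterated covariant derivatives and cancel in pairs.
  have j : nabla (mlieBracket I X (mlieBracket I Y Z)) W x =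
      nabla (mlieBracket I (mlieBracket I X Y) Z) W x
        + nabla (mlieBracket I Y (mlieBracket I X Z)) W x := by
    rw [← nabla_add_left]
    exact nabla_congr_left (mlieBracket_jacobi hX hY hZ)
  have b1 : nabla (mlieBracket I (mlieBracket I Y Z) X) W x =
      - nabla (mlieBracket I X (mlieBracket I Y Z)) W x := by
    have : mlieBracket I (mlieBracket I Y Z) X x = - mlieBracket I X (mlieBracket I Y Z) x :=
      mlieBracket_swap_apply
    simp [nabla, this]
  have b2 : nabla (mlieBracket I (mlieBracket I Z X) Y) W x =
      nabla (mlieBracket I Y (mlieBracket I X Z)) W x := by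
    have : mlieBracket I (mlieBracket I Z X) Y x = mlieBracket I Y (mlieBracket I X Z) x := by
      rw [mlieBracket_swap_apply, mlieBracket_swap (V := Z)]
      have h := mlieBracket_const_smul_right (W := mlieBracket I X Z) (V := Y) (c := (-1 : ℝ))
        (hX.mlieBracket hZ).mdifferentiableAt
      simp only [neg_smul, one_smul] at h
      rw [h, neg_neg]
    simp [nabla, this]
  simp only [nablaCurvature]
  rw [nabla_curvature_eq hY hZ hW, nabla_curvature_eq hZ hX hW,
    nabla_curvature_eq hX hY hW]
  have r1 : curvature X Y (nabla Z W) x = _ := curvature_apply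
  have r2 : curvature Y Z (nabla X W) x = _ := curvature_apply
  have r3 : curvature Z X (nabla Y W) x = _ := curvature_apply
  have q1 : curvature (mlieBracket I X Y) Z W x = _ := curvature_apply
  have q2 : curvature (mlieBracket I Y Z) X W x = _ := curvature_apply
  have q3 : curvature (mlieBracket I Z X) Y W x = _ := curvature_apply
  rw [s2, s3, s4, sub_eq_iff_eq_add.1 e1, sub_eq_iff_eq_add.1 e2, sub_eq_iff_eq_add.1 e3,
    r1, r2, r3, q1, q2, q3, b1, b2, j]
  abel

theorem nablaRiemann_cyclic (hX : SmoothAt X x) (hY : SmoothAt Y x) (hZ : SmoothAt Z x)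
    (hW : SmoothAt W x) (hT : SmoothAt T x) :
    nablaRiemann X Y Z W T x + nablaRiemann Y Z X W T x + nablaRiemann Z X Y W T x = 0 := by
  rw [nablaRiemann_eq_inner hX hY hZ hW hT, nablaRiemann_eq_inner hY hZ hX hW hT,
    nablaRiemann_eq_inner hZ hX hY hW hT, ← inner_add_left, ← inner_add_left,
    nablaCurvature_cyclic hX hY hZ hW, inner_zero_left]

theorem nablaRiemann_swap_left : nablaRiemann X Z Y W T x = - nablaRiemann X Y Z W T x := by
  have h : riemann Z Y W T = -riemann Y Z W T := by ext y; exact riemann_swap_left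
  simp only [nablaRiemann]
  rw [h, mvfderiv_neg, riemann_swap_left (X := nabla X Y) (Y := Z),
    riemann_swap_left (X := Y) (Y := nabla X Z), riemann_swap_left (Z := nabla X W),
    riemann_swap_left (W := nabla X T)]
  simp only [neg_apply]
  ring

theorem nablaRiemann_swap_right (hX : SmoothAt X x) (hY : ∀ᶠ y in 𝓝 x, SmoothAt Y y)
    (hZ : ∀ᶠ y in 𝓝 x, SmoothAt Z y) (hW : ∀ᶠ y in 𝓝 x, SmoothAt W y)
    (hT : ∀ᶠ y in 𝓝 x, SmoothAt T y) :
    nablaRiemann X Y Z T W x = - nablaRiemann X Y Z W T x := by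
  have h : riemann Y Z T W =ᶠ[𝓝 x] -riemann Y Z W T := by
    filter_upwards [hY, hZ, hW, hT] with y h1 h2 h3 h4 using riemann_swap_right h1 h2 h3 h4
  have hY := hY.self_of_nhds
  have hZ := hZ.self_of_nhds
  have hW := hW.self_of_nhds
  have hT := hT.self_of_nhds
  simp only [nablaRiemann]
  rw [mvfderiv_congr h, mvfderiv_neg, riemann_swap_right (hX.nabla hY) hZ hW hT,
    riemann_swap_right hY (hX.nabla hZ) hW hT, riemann_swap_right hY hZ (hX.nabla hW) hT,
    riemann_swap_right hY hZ hW (hX.nabla hT)]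
  simp only [neg_apply]
  ring

/-- The covariant derivative `(∇_X Ric)(Y, Z)` of the Ricci tensor. -/
def nablaRicci (X Y Z : Π x : M, TangentSpace I x) (x : M) : ℝ :=
  mvfderiv I (fun y => ricci y (Y y) (Z y)) x (X x) - ricci x (nabla X Y x) (Z x)
    - ricci x (Y x) (nabla X Z x)

theorem mvfderiv_sum {ι : Type} {s : Finset ι} {F : ι → M → ℝ} (hF : ∀ i ∈ s, MDiffAt (F i) x) :
    mvfderiv I (fun y => ∑ i ∈ s, F i y) x = ∑ i ∈ s, mvfderiv I (F i) x := by
  classical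
  induction s using Finset.induction_on with
  | empty => simp [mvfderiv_const]
  | insert i s hi ih =>
    have h := ih fun j hj => hF j (Finset.mem_insert_of_mem hj)
    have hs : MDiffAt (fun y => ∑ j ∈ s, F j y) x := by
      have e : (fun y => ∑ j ∈ s, F j y) = ∑ j ∈ s, F j := by
        ext y
        rw [Finset.sum_apply]
      rw [e]
      exact MDifferentiableAt.sum fun j hj => hF j (Finset.mem_insert_of_mem hj)
    have e : (fun y => ∑ j ∈ insert i s, F j y) = F i + fun y => ∑ j ∈ s, F j y := by
      ext y
      simp [Finset.sum_insert hi]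
    rw [e, mvfderiv_add (hF i (Finset.mem_insert_self i s)) hs, h, Finset.sum_insert hi]

namespace IsOrthonormalFrameOn

variable {e : Fin (Module.finrank ℝ E) → Π x : M, TangentSpace I x} {U : Set M}

theorem eventually_smoothAt (he : IsOrthonormalFrameOn I M e U) (hx : x ∈ U)
    (i : Fin (Module.finrank ℝ E)) : ∀ᶠ y in 𝓝 x, SmoothAt (e i) y := by
  filter_upwards [he.isOpen.mem_nhds hx] with y hy using he.smoothAt i y hy

/-- Since ⟨e i, e j⟩ is constant near `x`, metric compatibility makes the matrix of ∇_X e skew. -/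
theorem sum_bilin_nabla (he : IsOrthonormalFrameOn I M e U) (hx : x ∈ U) (hX : SmoothAt X x)
    (B : TangentSpace I x →ₗ[ℝ] TangentSpace I x →ₗ[ℝ] ℝ) :
    ∑ i, (B (nabla X (e i) x) (e i x) + B (e i x) (nabla X (e i) x)) = 0 := by
  have h := sum_bilin_add_bilin_eq_zero (he.basis hx) B (n := fun i => nabla X (e i) x) ?_
  · simpa only [he.basis_apply] using h
  intro i j
  rw [he.basis_apply, he.basis_apply, ← mvfderiv_inner hX.mdifferentiableAt
    (he.smoothAt i x hx).mdifferentiableAt (he.smoothAt j x hx).mdifferentiableAt]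
  have hc : (fun y => inner ℝ (e i y) (e j y)) =ᶠ[𝓝 x] fun _ => if i = j then (1 : ℝ) else 0 := by
    filter_upwards [he.isOpen.mem_nhds hx] with y hy
    exact orthonormal_iff_ite.1 (he.orthonormal y hy) i j
  rw [mvfderiv_congr hc, mvfderiv_const]
  simp

/-- Contraction commutes with ∇: the terms that differentiate the frame cancel by `sum_bilin_nabla`.
-/
theorem sum_nablaRiemann (he : IsOrthonormalFrameOn I M e U) (hx : x ∈ U) (hX : SmoothAt X x)
    (hY : ∀ᶠ y in 𝓝 x, SmoothAt Y y) (hZ : ∀ᶠ y in 𝓝 x, SmoothAt Z y) :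
    ∑ i, nablaRiemann X (e i) Y Z (e i) x = nablaRicci X Y Z x := by
  have hY' := hY.self_of_nhds
  have hZ' := hZ.self_of_nhds
  have hei := fun i => he.smoothAt i x hx
  have h1 : (fun y => ricci y (Y y) (Z y)) =ᶠ[𝓝 x] fun y => ∑ i, riemann (e i) Y Z (e i) y := by
    filter_upwards [he.isOpen.mem_nhds hx, hY, hZ] with y hy h2 h3 using he.ricci_eq hy h2 h3
  have h2 := he.sum_bilin_nabla hx hX (curvatureForm hY' hZ')
  have h3 : ∀ i, curvatureForm hY' hZ' (nabla X (e i) x) (e i x) =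
      riemann (nabla X (e i)) Y Z (e i) x := fun i =>
    curvatureForm_apply hY' hZ' (hX.nabla (hei i))
  have h4 : ∀ i, curvatureForm hY' hZ' (e i x) (nabla X (e i) x) =
      riemann (e i) Y Z (nabla X (e i)) x := fun i =>
    curvatureForm_apply hY' hZ' (hei i)
  simp only [h3, h4] at h2
  rw [nablaRicci, mvfderiv_congr h1, mvfderiv_sum fun i _ =>
    (contMDiffAt_riemann (hei i) hY' hZ' (hei i)).mdifferentiableAt (by simp),
    he.ricci_eq hx (hX.nabla hY') hZ', he.ricci_eq hx hY' (hX.nabla hZ'),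
    sum_apply]
  rw [Finset.sum_add_distrib] at h2
  simp only [nablaRiemann, Finset.sum_sub_distrib]
  linarith

theorem sum_nablaRicci (he : IsOrthonormalFrameOn I M e U) (hx : x ∈ U) (hX : SmoothAt X x) :
    ∑ i, nablaRicci X (e i) (e i) x = mvfderiv I (scalarCurvature I) x (X x) := by
  have hei := fun i => he.smoothAt i x hx
  have h1 : (scalarCurvature I : M → ℝ) =ᶠ[𝓝 x] fun y => ∑ i, ricci y (e i y) (e i y) := by
    filter_upwards [he.isOpen.mem_nhds hx] with y hy
    rw [scalarCurvature_eq_sum_ricci (he.basis hy)]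
    simp only [he.basis_apply]
  have h2 := he.sum_bilin_nabla hx hX (ricciForm x)
  simp only [ricciForm_apply] at h2
  -- The vanishing sum `h2` is subtracted as a zero, so that the two sides agree term by term.
  rw [mvfderiv_congr h1, mvfderiv_sum fun i _ => (contMDiffAt_ricci (hei i) (hei i)
    (he.eventually_smoothAt hx i) (he.eventually_smoothAt hx i)).mdifferentiableAt (by simp),
    sum_apply, ← sub_zero (Finset.sum _ fun i => mvfderiv I _ x _), ← h2,
    ← Finset.sum_sub_distrib]
  refine Finset.sum_congr rfl fun i _ => ?_
  rw [nablaRicci]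
  ring

/-- The contracted second Bianchi identity `div Ric = dS / 2`. -/
theorem two_mul_sum_nablaRicci (he : IsOrthonormalFrameOn I M e U) (hx : x ∈ U)
    (hX : ∀ᶠ y in 𝓝 x, SmoothAt X y) :
    2 * ∑ i, nablaRicci (e i) X (e i) x = mvfderiv I (scalarCurvature I) x (X x) := by
  have hX' := hX.self_of_nhds
  have hei := fun i => he.smoothAt i x hx
  have hee := fun i => he.eventually_smoothAt hx i
  -- The second Bianchi identity, rearranged so that both terms on the right contract to the
  -- divergence of Ric. This is the source of the factor 2.
  have key : ∀ i j, nablaRiemann X (e i) (e j) (e j) (e i) x =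
      nablaRiemann (e i) (e j) X (e i) (e j) x + nablaRiemann (e j) (e i) X (e j) (e i) x := by
    intro i j
    have h := nablaRiemann_cyclic hX' (hei i) (hei j) (hei j) (hei i)
    have h1 := nablaRiemann_swap_right (hei i) (hee j) hX (hee i) (hee j)
    have h2 : nablaRiemann (e j) X (e i) (e j) (e i) x = _ := nablaRiemann_swap_left
    rw [h1, h2] at h
    linarith
  rw [← he.sum_nablaRicci hx hX']
  have h1 : ∀ j, nablaRicci X (e j) (e j) x = ∑ i, nablaRiemann X (e i) (e j) (e j) (e i) x :=
    fun j => (he.sum_nablaRiemann hx hX' (hee j) (hee j)).symm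
  simp_rw [h1, key, Finset.sum_add_distrib]
  rw [Finset.sum_comm]
  simp_rw [he.sum_nablaRiemann hx (hei _) hX (hee _)]
  ring

end IsOrthonormalFrameOn

end Bianchi

/-! ### Divergence, the Ricci field and the Lie derivative of the metric. -/

/-- The divergence of a vector field, the trace of its covariant derivative. -/
def divergence (X : Π x : M, TangentSpace I x) (x : M) : ℝ :=
  ∑ i, inner ℝ (leviCivita I M X x (frame I x i)) (frame I x i)

section Divergence

variable {X Y Z W V : Π x : M, TangentSpace I x} {f : M → ℝ} {x : M}

/-- The bilinear form `(v, w) ↦ g(∇_v X, w)`. -/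
def nablaForm (X : Π x : M, TangentSpace I x) (x : M) :
    TangentSpace I x →ₗ[ℝ] TangentSpace I x →ₗ[ℝ] ℝ :=
  LinearMap.mk₂ ℝ (fun v w => inner ℝ (leviCivita I M X x v) w)
    (fun v v' w => by rw [map_add, inner_add_left])
    (fun c v w => by rw [map_smul, real_inner_smul_left, smul_eq_mul])
    (fun v w w' => inner_add_right _ _ _)
    (fun c v w => real_inner_smul_right _ _ _)

theorem nablaForm_apply (v w : TangentSpace I x) :
    nablaForm X x v w = inner ℝ (leviCivita I M X x v) w := rfl

theorem divergence_eq_sum {ι : Type*} [Fintype ι] (b : OrthonormalBasis ι ℝ (TangentSpace I x)) :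
    divergence X x = ∑ i, inner ℝ (leviCivita I M X x (b i)) (b i) :=
  sum_bilin_orthonormalBasis (frame I x) b (nablaForm X x)

theorem IsOrthonormalFrameOn.divergence_eq
    {e : Fin (Module.finrank ℝ E) → Π x : M, TangentSpace I x} {U : Set M}
    (he : IsOrthonormalFrameOn I M e U) (hx : x ∈ U) :
    divergence X x = ∑ i, inner ℝ (nabla (e i) X x) (e i x) := by
  rw [divergence_eq_sum (he.basis hx)]
  simp only [he.basis_apply]
  rfl

theorem divergence_add (hX : MDiffAt (T% X) x) (hY : MDiffAt (T% Y) x) :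
    divergence (X + Y) x = divergence X x + divergence Y x := by
  have h : leviCivita I M (X + Y) x = leviCivita I M X x + leviCivita I M Y x :=
    isCovariantDerivativeOn_leviCivitaFun.add hX hY (mem_univ x)
  simp only [divergence, h, add_apply, inner_add_left, Finset.sum_add_distrib]

theorem divergence_sub (hX : MDiffAt (T% X) x) (hY : MDiffAt (T% Y) x) :
    divergence (X - Y) x = divergence X x - divergence Y x := by
  have h := divergence_add (mdifferentiableAt_sub_section hX hY) hY
  rw [sub_add_cancel] at h
  linarith

theorem divergence_smul (hf : MDiffAt f x) (hX : MDiffAt (T% X) x) :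
    divergence (f • X) x = f x * divergence X x + mvfderiv I f x (X x) := by
  have h := fun v : TangentSpace I x =>
    congrArg (fun L => L v) (isCovariantDerivativeOn_leviCivitaFun.leibniz hX hf (mem_univ x))
  have h' : ∀ v : TangentSpace I x, leviCivita I M (f • X) x v =
      f x • leviCivita I M X x v + mvfderiv I f x v • X x := h
  have h3 : mvfderiv I f x (X x) = ∑ i, mvfderiv I f x (frame I x i) *
      inner ℝ (X x) (frame I x i) := by
    conv_lhs => rw [← (frame I x).sum_repr' (X x)]
    simp only [map_sum, map_smul, smul_eq_mul]
    exact Finset.sum_congr rfl fun i _ => by rw [real_inner_comm, mul_comm]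
  simp only [divergence, h', inner_add_left, real_inner_smul_left, Finset.sum_add_distrib,
    Finset.mul_sum, h3]

theorem divergence_congr (hX : MDiffAt (T% X) x) (h : Y =ᶠ[𝓝 x] X) :
    divergence Y x = divergence X x := by
  have e : ∀ v : TangentSpace I x, leviCivita I M Y x v = leviCivita I M X x v := by
    intro v
    have := nabla_congr_right (X := extend E v) hX h
    simpa [nabla] using this
  simp only [divergence, e]

theorem contMDiffAt_divergence (hX : SmoothAt X x) : CMDiffAt ∞ (divergence X) x := by
  obtain ⟨e, U, hx, he⟩ := exists_isOrthonormalFrameOn (I := I) x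
  have hs : CMDiffAt ∞ (fun y => ∑ i, inner ℝ (nabla (e i) X y) (e i y)) x :=
    ContMDiffAt.sum fun i _ => ((he.smoothAt i x hx).nabla hX).inner (he.smoothAt i x hx)
  refine hs.congr_of_eventuallyEq ?_
  filter_upwards [he.isOpen.mem_nhds hx] with y hy using he.divergence_eq hy

/-- The vector field dual to the one-form `Ric(X, ·)`. -/
def ricciField (X : Π x : M, TangentSpace I x) : Π x : M, TangentSpace I x :=
  fun y => ∑ i, ricci y (X y) (frame I y i) • frame I y i

theorem inner_ricciField (v : TangentSpace I x) :
    inner ℝ (ricciField X x) v = ricci x (X x) v := by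
  rw [← ricciForm_apply, ricciField, sum_inner]
  conv_rhs => rw [← (frame I x).sum_repr' v]
  simp only [map_sum, map_smul, real_inner_smul_left, smul_eq_mul, ricciForm_apply]
  exact Finset.sum_congr rfl fun i _ => mul_comm _ _

theorem smoothAt_ricciField (hX : ∀ᶠ y in 𝓝 x, SmoothAt X y) : SmoothAt (ricciField X) x := by
  obtain ⟨e, U, hx, he⟩ := exists_isOrthonormalFrameOn (I := I) x
  refine he.smoothAt_of_inner hx fun i => ?_
  simp only [inner_ricciField]
  exact contMDiffAt_ricci hX.self_of_nhds (he.smoothAt i x hx) hX (he.eventually_smoothAt hx i)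

/-- Product rule div(Ric X) = (div Ric)(X) + ⟨Ric, ∇X⟩, with div Ric = dS/2. -/
theorem divergence_ricciField (hX : ∀ᶠ y in 𝓝 x, SmoothAt X y) {ι : Type*} [Fintype ι]
    (b : OrthonormalBasis ι ℝ (TangentSpace I x)) :
    divergence (ricciField X) x = mvfderiv I (scalarCurvature I) x (X x) / 2 +
      ∑ i, ricci x (leviCivita I M X x (b i)) (b i) := by
  obtain ⟨e, U, hx, he⟩ := exists_isOrthonormalFrameOn (I := I) x
  have h1 := sum_bilin_orthonormalBasis b (he.basis hx)
    ((ricciForm x).comp (leviCivita I M X x : TangentSpace I x →ₗ[ℝ] TangentSpace I x))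
  simp only [LinearMap.comp_apply, ContinuousLinearMap.coe_coe, ricciForm_apply,
    he.basis_apply] at h1
  rw [h1, ← he.two_mul_sum_nablaRicci hx hX, he.divergence_eq hx, mul_div_cancel_left₀ _ two_ne_zero,
    ← Finset.sum_add_distrib]
  refine Finset.sum_congr rfl fun i _ => ?_
  have hi := (he.smoothAt i x hx).mdifferentiableAt
  have h2 := mvfderiv_inner hi (smoothAt_ricciField hX).mdifferentiableAt hi
  simp only [inner_ricciField] at h2
  rw [nablaRicci, h2]
  simp only [nabla]
  ring

theorem lieDerivMetric_eq (hX : MDiffAt (T% X) x) (hY : MDiffAt (T% Y) x) (hZ : MDiffAt (T% Z) x) :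
    lieDerivMetric X Y Z x =
      inner ℝ (leviCivita I M X x (Y x)) (Z x) + inner ℝ (Y x) (leviCivita I M X x (Z x)) := by
  rw [lieDerivMetric, mvfderiv_inner hX hY hZ, ← nabla_sub_nabla hX hY, ← nabla_sub_nabla hX hZ,
    inner_sub_left, inner_sub_right]
  simp only [nabla]
  ring

theorem mvfderiv_const_mul {c : ℝ} (hf : MDiffAt f x) :
    mvfderiv I (fun y => c * f y) x = c • mvfderiv I f x := by
  rw [mvfderiv_fun_mul mdifferentiableAt_const hf, mvfderiv_const, smul_zero, add_zero]

/-- The soliton and Killing equations are tested on global smooth fields only. Cutting off a local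
extension by a bump function makes them available on every tangent vector. -/
theorem exists_isSmoothField [T2Space M] (v : TangentSpace I x) :
    ∃ X : Π x : M, TangentSpace I x, IsSmoothField X ∧ X x = v := by
  obtain ⟨s, hs, hsm⟩ := exists_contMDiffOn_extend (k := ∞) I E v
  obtain ⟨f, -, hf⟩ := (SmoothBumpFunction.nhds_basis_tsupport (I := I) x).mem_iff.1
    (interior_mem_nhds.2 hs)
  refine ⟨(f : M → ℝ) • extend E v, ContMDiffOn.smul_section_of_tsupport f.contMDiff.contMDiffOn
    isOpen_interior hf (hsm.mono interior_subset), ?_⟩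
  simp

/-- The symmetric part `L_X g / 2` of the covariant derivative as a bilinear form. -/
def symmForm (X : Π x : M, TangentSpace I x) (x : M) (v w : TangentSpace I x) : ℝ :=
  (inner ℝ (leviCivita I M X x v) w + inner ℝ v (leviCivita I M X x w)) / 2

theorem IsAlmostRBSoliton.ricci_eq [T2Space M] {ξ : Π x : M, TangentSpace I x} {lam : M → ℝ}
    {ρ : ℝ} (h : IsAlmostRBSoliton ξ lam ρ) (v w : TangentSpace I x) :
    ricci x v w = (lam x + ρ * scalarCurvature I x) * inner ℝ v w - symmForm ξ x v w := by
  obtain ⟨X, hX, rfl⟩ := exists_isSmoothField v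
  obtain ⟨Y, hY, rfl⟩ := exists_isSmoothField w
  have he := h.equation X Y hX hY x
  rw [lieDerivMetric_eq (h.smooth_field.mdifferentiable (by simp) x)
    (hX.mdifferentiable (by simp) x) (hY.mdifferentiable (by simp) x)] at he
  rw [symmForm, ← he]
  ring

/-- The pairing of ∇X with its symmetric part sees no skew part, so it is the squared norm of the
symmetric part. -/
theorem sum_symmForm {ι : Type*} [Fintype ι] (b : OrthonormalBasis ι ℝ (TangentSpace I x)) :
    ∑ i, symmForm X x (leviCivita I M X x (b i)) (b i) = ∑ i, ∑ j, symmForm X x (b i) (b j) ^ 2 := by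
  set N := leviCivita I M X x
  set n : ι → ι → ℝ := fun i j => inner ℝ (N (b i)) (b j) with hn
  have h1 : ∀ i, symmForm X x (N (b i)) (b i) = ∑ j, (n i j * n j i + n i j * n i j) / 2 := by
    intro i
    rw [← Finset.sum_div, Finset.sum_add_distrib]
    have e1 : (inner ℝ (N (N (b i))) (b i) : ℝ) = ∑ j, n i j * n j i := by
      conv_lhs => rw [← b.sum_repr' (N (b i))]
      simp only [map_sum, map_smul, sum_inner, real_inner_smul_left, n]
      exact Finset.sum_congr rfl fun j _ => by rw [real_inner_comm (b j)]
    have e2 : (inner ℝ (N (b i)) (N (b i)) : ℝ) = ∑ j, n i j * n i j := by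
      rw [← b.sum_inner_mul_inner]
      exact Finset.sum_congr rfl fun j _ => by rw [real_inner_comm (N (b i)) (b j)]
    rw [← e1, ← e2]
    rfl
  have h2 : ∀ i j, symmForm X x (b i) (b j) ^ 2 =
      (n i j * n j i + n i j * n i j) / 4 + (n i j * n j i + n j i * n j i) / 4 := by
    intro i j
    have : symmForm X x (b i) (b j) = (n i j + n j i) / 2 := by
      simp only [symmForm, n]
      rw [real_inner_comm (b i)]
    rw [this]
    ring
  simp_rw [h1, h2, Finset.sum_add_distrib]
  conv_rhs => enter [2]; rw [Finset.sum_comm]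
  rw [← Finset.sum_add_distrib]
  refine Finset.sum_congr rfl fun i _ => ?_
  rw [← Finset.sum_add_distrib]
  exact Finset.sum_congr rfl fun j _ => by ring

theorem sum_symmForm_self {ι : Type*} [Fintype ι] (b : OrthonormalBasis ι ℝ (TangentSpace I x)) :
    ∑ i, symmForm X x (b i) (b i) = divergence X x := by
  rw [divergence_eq_sum b]
  refine Finset.sum_congr rfl fun i _ => ?_
  rw [symmForm, real_inner_comm (b i)]
  ring

end Divergence

/-! ### The soliton divergence formula and Schur's lemma. -/

section Soliton

variable [T2Space M] {ξ : Π x : M, TangentSpace I x} {lam : M → ℝ} {ρ : ℝ}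

/-- The trace of the soliton equation. -/
theorem IsAlmostRBSoliton.divergence_eq (h : IsAlmostRBSoliton ξ lam ρ) (x : M) :
    divergence ξ x = Module.finrank ℝ E * (lam x + ρ * scalarCurvature I x)
      - scalarCurvature I x := by
  have h1 := sum_symmForm_self (X := ξ) (frame I x)
  have h2 := scalarCurvature_eq_sum_ricci (frame I x)
  simp only [h.ricci_eq, Finset.sum_sub_distrib, h1, ← Finset.mul_sum,
    orthonormal_iff_ite.1 (frame I x).orthonormal] at h2
  simp only [if_true, Finset.sum_const, Finset.card_univ, Fintype.card_fin, nsmul_eq_mul,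
    mul_one] at h2
  have h3 : Module.finrank ℝ (TangentSpace I x) = Module.finrank ℝ E := rfl
  rw [h3] at h2
  linarith

theorem IsAlmostRBSoliton.contMDiff_factor (h : IsAlmostRBSoliton ξ lam ρ) :
    CMDiff ∞ (fun x => lam x + ρ * scalarCurvature I x) :=
  h.smooth_function.add (contMDiff_const.mul contMDiff_scalarCurvature)

/-- The vector field whose divergence is `‖L_ξ g‖² / 4 + (n - 3) / 2 * (div ξ)²` when
`(n - 1) (lam + ρ S) - S` is constant along `ξ`. -/
def solitonField (ξ : Π x : M, TangentSpace I x) (lam : M → ℝ) (ρ : ℝ) :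
    Π x : M, TangentSpace I x :=
  (fun x => ((Module.finrank ℝ E : ℝ) / 2 - 1) * (((Module.finrank ℝ E : ℝ) - 1) *
    (lam x + ρ * scalarCurvature I x) - scalarCurvature I x) + 2⁻¹ * scalarCurvature I x) • ξ
    - ricciField ξ

theorem IsAlmostRBSoliton.contMDiff_coeff (h : IsAlmostRBSoliton ξ lam ρ) (c c' : ℝ) :
    CMDiff ∞ (fun x => c * (c' * (lam x + ρ * scalarCurvature I x) - scalarCurvature I x)
      + 2⁻¹ * scalarCurvature I x) := by
  have hS : CMDiff ∞ (scalarCurvature I : M → ℝ) := contMDiff_scalarCurvature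
  exact (contMDiff_const.mul ((contMDiff_const.mul h.contMDiff_factor).sub hS)).add
    (contMDiff_const.mul hS)

theorem IsAlmostRBSoliton.smoothAt_solitonField (h : IsAlmostRBSoliton ξ lam ρ) (x : M) :
    SmoothAt (solitonField ξ lam ρ) x :=
  (SmoothAt.smul (h.contMDiff_coeff _ _ x) (h.smooth_field x)).sub
    (smoothAt_ricciField (Filter.Eventually.of_forall h.smooth_field))

/-- The S/2 in the coefficient cancels the ½ ξ(S) from the contracted Bianchi identity. The factor
n/2 - 1 is the one for which the coefficient minus λ + ρS is a multiple of div ξ, namely (n-3)/2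
times it. -/
theorem IsAlmostRBSoliton.divergence_solitonField (h : IsAlmostRBSoliton ξ lam ρ) (x : M)
    (hc : mvfderiv I (fun x => ((Module.finrank ℝ E : ℝ) - 1) *
      (lam x + ρ * scalarCurvature I x) - scalarCurvature I x) x (ξ x) = 0)
    {ι : Type*} [Fintype ι] (b : OrthonormalBasis ι ℝ (TangentSpace I x)) :
    divergence (solitonField ξ lam ρ) x = ∑ i, ∑ j, symmForm ξ x (b i) (b j) ^ 2
      + ((Module.finrank ℝ E : ℝ) - 3) / 2 * divergence ξ x ^ 2 := by
  have hξ : ∀ᶠ y in 𝓝 x, SmoothAt ξ y := Filter.Eventually.of_forall h.smooth_field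
  have hS : MDiffAt (scalarCurvature I : M → ℝ) x :=
    contMDiff_scalarCurvature.mdifferentiable (by simp) x
  set n : ℝ := (Module.finrank ℝ E : ℝ) with hn
  have hF : MDiffAt (fun x => (n - 1) * (lam x + ρ * scalarCurvature I x)
      - scalarCurvature I x) x :=
    ((contMDiff_const.mul h.contMDiff_factor).sub contMDiff_scalarCurvature).mdifferentiable
      (n := ∞) (by simp) x
  have hd : mvfderiv I (fun x => (n / 2 - 1) * ((n - 1) * (lam x + ρ * scalarCurvature I x)
      - scalarCurvature I x) + 2⁻¹ * scalarCurvature I x) x (ξ x) =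
      mvfderiv I (scalarCurvature I) x (ξ x) / 2 := by
    have hA : MDiffAt (fun x => (n / 2 - 1) * ((n - 1) * (lam x + ρ * scalarCurvature I x)
      - scalarCurvature I x)) x := mdifferentiableAt_const.mul hF
    have hB : MDiffAt (fun x : M => 2⁻¹ * scalarCurvature I x) x := mdifferentiableAt_const.mul hS
    rw [mvfderiv_fun_add hA hB,
      mvfderiv_const_mul hF, mvfderiv_const_mul hS, add_apply, smul_apply, smul_apply, hc]
    simp [div_eq_inv_mul]
  have hR : ∀ i, ricci x (leviCivita I M ξ x (b i)) (b i) = (lam x + ρ * scalarCurvature I x) *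
      inner ℝ (leviCivita I M ξ x (b i)) (b i) - symmForm ξ x (leviCivita I M ξ x (b i)) (b i) :=
    fun i => h.ricci_eq _ _
  have hdiv := h.divergence_eq x
  rw [solitonField, divergence_sub (SmoothAt.smul (h.contMDiff_coeff _ _ x)
      (h.smooth_field x)).mdifferentiableAt (smoothAt_ricciField hξ).mdifferentiableAt,
    divergence_smul ((h.contMDiff_coeff _ _).mdifferentiable (by simp) x)
      (hξ.self_of_nhds.mdifferentiableAt), divergence_ricciField hξ b, hd]
  simp_rw [hR]
  rw [Finset.sum_sub_distrib, sum_symmForm, ← Finset.mul_sum, ← divergence_eq_sum b]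
  rw [← hn] at hdiv ⊢
  set Q := ∑ i, ∑ j, symmForm ξ x (b i) (b j) ^ 2
  have hS' : scalarCurvature I x = n * (lam x + ρ * scalarCurvature I x) - divergence ξ x := by
    linarith
  generalize lam x + ρ * scalarCurvature I x = f at hS' ⊢
  rw [hS']
  ring

end Soliton

/-- Schur's lemma. -/
theorem mvfderiv_eq_zero_of_ricci_eq {f : M → ℝ} (hf : CMDiff ∞ f)
    (hn : Module.finrank ℝ E ≠ 2)
    (h : ∀ (y : M) (v w : TangentSpace I y), ricci y v w = f y * inner ℝ v w) (x : M) :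
    mvfderiv I f x = 0 := by
  ext v
  obtain ⟨e, U, hx, he⟩ := exists_isOrthonormalFrameOn (I := I) x
  have hfx : MDiffAt f x := hf.mdifferentiable (by simp) x
  have hS : (scalarCurvature I : M → ℝ) = fun y => (Module.finrank ℝ E : ℝ) * f y := by
    ext y
    have h3 : Module.finrank ℝ (TangentSpace I y) = Module.finrank ℝ E := rfl
    rw [scalarCurvature_eq_sum_ricci (frame I y)]
    simp only [h, orthonormal_iff_ite.1 (frame I y).orthonormal, if_true, Finset.sum_const,
      Finset.card_univ, Fintype.card_fin, nsmul_eq_mul, mul_one, h3]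
  -- An extension of `v` with constant coefficients in the frame, smooth on a whole neighbourhood of
  -- `x`, as the contracted Bianchi identity requires.
  set X : Π x : M, TangentSpace I x :=
    fun y => ∑ j, ((fun _ : M => (inner ℝ (e j x) v : ℝ)) • e j) y with hXdef
  have hX : ∀ᶠ y in 𝓝 x, SmoothAt X y := by
    filter_upwards [he.isOpen.mem_nhds hx] with y hy
    exact SmoothAt.sum fun j _ => SmoothAt.smul contMDiffAt_const (he.smoothAt j y hy)
  have hXx : X x = v := he.sum_inner_smul hx v
  have h2 := he.two_mul_sum_nablaRicci hx hX
  have h4 : ∀ i, nablaRicci (e i) X (e i) x = mvfderiv I f x (inner ℝ (e i x) v • e i x) := by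
    intro i
    have hi := (he.smoothAt i x hx).mdifferentiableAt
    have hX' := hX.self_of_nhds.mdifferentiableAt
    simp only [nablaRicci, h]
    rw [mvfderiv_fun_mul hfx (mdifferentiableAt_inner hX' hi), add_apply, smul_apply, smul_apply,
      mvfderiv_inner hi hX' hi, hXx, map_smul, real_inner_comm v]
    simp only [smul_eq_mul]
    ring
  simp_rw [h4] at h2
  rw [← map_sum, he.sum_inner_smul hx v, hS, mvfderiv_const_mul hfx, hXx, smul_apply,
    smul_eq_mul] at h2
  -- Here div Ric = df and S = nf, so 2 div Ric = dS becomes 2 df = n df.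
  have h5 : ((Module.finrank ℝ E : ℝ) - 2) * mvfderiv I f x v = 0 := by linarith
  have h6 : (Module.finrank ℝ E : ℝ) - 2 ≠ 0 := by
    rw [sub_ne_zero]
    exact_mod_cast hn
  simpa [h6] using h5

/-! ### Coordinate fields and the Riemannian volume density. -/

/-- Jacobi's formula: the determinant is multilinear in the rows, and Cramer's rule identifies the
determinant with one row replaced as a row of the adjugate pairing. -/
theorem hasFDerivAt_det {ι : Type*} [Fintype ι] [DecidableEq ι] {F : Type*} [NormedAddCommGroup F]
    [NormedSpace ℝ F] {G : F → ι → ι → ℝ} {G' : ι → ι → F →L[ℝ] ℝ} {y : F}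
    (hG : ∀ i j, HasFDerivAt (fun z => G z i j) (G' i j) y) :
    HasFDerivAt (fun z => (Matrix.of (G z)).det)
      (∑ i, ∑ j, (Matrix.of (G y)).adjugate j i • G' i j) y := by
  let D : ContinuousMultilinearMap ℝ (fun _ : ι => ι → ℝ) ℝ :=
    ⟨(Matrix.detRowAlternating (R := ℝ) (n := ι)).toMultilinearMap,
      Continuous.matrix_det (A := fun B : ι → ι → ℝ => (B : Matrix ι ι ℝ)) continuous_id⟩
  have h2 : HasFDerivAt G (ContinuousLinearMap.pi fun i => ContinuousLinearMap.pi (G' i)) y :=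
    hasFDerivAt_pi.2 fun i => hasFDerivAt_pi.2 fun j => hG i j
  refine ((D.hasFDerivAt (G y)).comp y h2).congr_fderiv ?_
  ext v
  rw [ContinuousLinearMap.comp_apply, ContinuousMultilinearMap.linearDeriv_apply]
  simp only [sum_apply, smul_apply, smul_eq_mul]
  refine Finset.sum_congr rfl fun i _ => ?_
  have h3 := Matrix.cramer_transpose_apply (Matrix.of (G y)) (fun j => G' i j v) i
  rw [Matrix.cramer_eq_adjugate_mulVec, ← Matrix.adjugate_transpose] at h3
  exact h3.symm

section Coordinates

variable {E : Type*} [NormedAddCommGroup E] [NormedSpace ℝ E] [FiniteDimensional ℝ E]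
  {M : Type*} [TopologicalSpace M] [ChartedSpace E M] [IsManifold 𝓘(ℝ, E) ∞ M]

/-- The constant vector field on a vector space. -/
def constField (v : E) (y : E) : TangentSpace 𝓘(ℝ, E) y := v

theorem mdifferentiableAt_constField (v y : E) : MDiffAt (T% (constField v)) y := by
  refine ContMDiffAt.mdifferentiableAt (n := 1) ?_ one_ne_zero
  exact contMDiffAt_vectorSpace_iff_contDiffAt.2
    (contDiffAt_const (c := v) : ContDiffAt ℝ 1 (fun _ : E => v) y)

theorem mlieBracket_constField (v w : E) :
    mlieBracket 𝓘(ℝ, E) (constField v) (constField w) = 0 := by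
  have h : lieBracketWithin ℝ (fun _ : E => v) (fun _ : E => w) univ = 0 := by
    rw [lieBracketWithin_univ]
    ext y
    simp [lieBracket_eq]
  rw [← mlieBracketWithin_univ]
  exact mlieBracketWithin_eq_lieBracketWithin.trans h

/-- The vector field near `p` that has the constant value `v` in the chart at `p`. -/
def coordField (p : M) (v : E) (x : M) : TangentSpace 𝓘(ℝ, E) x :=
  (trivializationAt E (TangentSpace 𝓘(ℝ, E)) p).symmL ℝ x v

variable {p q x : M} {v w : E}

theorem ContMDiffAt.contDiffAt_comp_extChartAt_symm {F : M → ℝ}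
    (hx : x ∈ (chartAt E p).source) (hF : CMDiffAt ∞ F x) :
    ContDiffAt ℝ ∞ (F ∘ (extChartAt 𝓘(ℝ, E) p).symm) (extChartAt 𝓘(ℝ, E) p x) := by
  have hx' : x ∈ (extChartAt 𝓘(ℝ, E) p).source := by rwa [extChartAt_source]
  have h1 : CMDiffAt ∞ (extChartAt 𝓘(ℝ, E) p).symm (extChartAt 𝓘(ℝ, E) p x) :=
    (contMDiffOn_extChartAt_symm p).contMDiffAt
      ((isOpen_extChartAt_target p).mem_nhds ((extChartAt 𝓘(ℝ, E) p).map_source hx'))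
  refine (ContMDiffAt.comp _ ?_ h1).contDiffAt
  rwa [(extChartAt 𝓘(ℝ, E) p).left_inv hx']

theorem smoothAt_coordField (hx : x ∈ (chartAt E p).source) : SmoothAt (coordField p v) x := by
  have h : CMDiff[(trivializationAt E (TangentSpace 𝓘(ℝ, E)) p).baseSet] ∞
      (T% (coordField p v)) := by
    rw [(trivializationAt E (TangentSpace 𝓘(ℝ, E)) p).contMDiffOn_section_baseSet_iff]
    apply (contMDiffOn_const (c := v)).congr
    intro y hy
    have := (trivializationAt E (TangentSpace 𝓘(ℝ, E)) p).apply_mk_symm hy v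
    have h2 : coordField p v y = (trivializationAt E (TangentSpace 𝓘(ℝ, E)) p).symm y v :=
      Trivialization.symmL_apply _ hy _
    rw [h2]
    exact congrArg Prod.snd this
  exact h.contMDiffAt ((chartAt E p).open_source.mem_nhds hx)

theorem mvfderiv_coordField {F : M → ℝ} (hx : x ∈ (chartAt E p).source) (hF : MDiffAt F x) :
    mvfderiv 𝓘(ℝ, E) F x (coordField p v x) =
      fderiv ℝ (F ∘ (extChartAt 𝓘(ℝ, E) p).symm) (extChartAt 𝓘(ℝ, E) p x) v := by
  have hx' : x ∈ (extChartAt 𝓘(ℝ, E) p).source := by rwa [extChartAt_source]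
  have h1 : MDiffAt (extChartAt 𝓘(ℝ, E) p).symm (extChartAt 𝓘(ℝ, E) p x) := by
    have := mdifferentiableWithinAt_extChartAt_symm (I := 𝓘(ℝ, E))
      ((extChartAt 𝓘(ℝ, E) p).map_source hx')
    rwa [modelWithCornersSelf_coe, range_id, mdifferentiableWithinAt_univ] at this
  have h2 := mfderiv_comp_of_eq (hF) h1 ((extChartAt 𝓘(ℝ, E) p).left_inv hx')
  rw [mfderiv_eq_fderiv] at h2
  rw [h2, coordField, TangentBundle.symmL_trivializationAt hx]
  simp only [modelWithCornersSelf_coe, range_id, mfderivWithin_univ]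
  rw [(extChartAt 𝓘(ℝ, E) p).left_inv hx']
  rfl

theorem mpullback_const_eq_coordField (hx : x ∈ (chartAt E p).source) :
    mpullback 𝓘(ℝ, E) 𝓘(ℝ, E) (extChartAt 𝓘(ℝ, E) p)
      (constField v) x = coordField p v x := by
  have hx' : x ∈ (extChartAt 𝓘(ℝ, E) p).source := by rwa [extChartAt_source]
  have h1 := (trivializationAt E (TangentSpace 𝓘(ℝ, E)) p).continuousLinearMapAt_symmL
    (R := ℝ) (b := x) hx v
  rw [TangentBundle.continuousLinearMapAt_trivializationAt hx] at h1
  exact ((isInvertible_mfderiv_extChartAt hx').inverse_apply_eq).2 h1.symm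

/-- Coordinate fields are pullbacks of constant fields, which commute, and pullback respects
brackets. -/
theorem mlieBracket_coordField (hx : x ∈ (chartAt E p).source) :
    mlieBracket 𝓘(ℝ, E) (coordField p v) (coordField p w) x = 0 := by
  have : CompleteSpace E := FiniteDimensional.complete ℝ E
  have h1 : ∀ u : E, coordField p u =ᶠ[𝓝 x] mpullback 𝓘(ℝ, E) 𝓘(ℝ, E) (extChartAt 𝓘(ℝ, E) p)
      (constField u) := fun u => by
    filter_upwards [(chartAt E p).open_source.mem_nhds hx] with y hy
    exact (mpullback_const_eq_coordField hy).symm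
  have h3 : IsManifold 𝓘(ℝ, E) (minSmoothness ℝ 2) M := by
    simp only [minSmoothness_of_isRCLikeNormedField]; infer_instance
  have h4 : IsManifold 𝓘(ℝ, E) (minSmoothness ℝ 3) M := by
    simp only [minSmoothness_of_isRCLikeNormedField]; infer_instance
  rw [Filter.EventuallyEq.mlieBracket_vectorField_eq (h1 v) (h1 w),
    ← mpullback_mlieBracket (n := ∞) (mdifferentiableAt_constField v _)
      (mdifferentiableAt_constField w _) (contMDiffAt_extChartAt' hx)
      (by simp only [minSmoothness_of_isRCLikeNormedField]; exact ENat.LEInfty.out)]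
  rw [mlieBracket_constField, mpullback_zero]
  rfl

end Coordinates

/-- If A is the matrix of L and G the Gram matrix, the bracket is the entry of AᵀG + GA. Its trace
against adj G is 2 det G · tr A, since G adj G = det G. -/
theorem sum_adjugate_gram_mul {ι : Type*} [Fintype ι] [DecidableEq ι] {V : Type*}
    [NormedAddCommGroup V] [InnerProductSpace ℝ V] (B : Module.Basis ι ℝ V) (L : V →ₗ[ℝ] V) :
    ∑ i, ∑ j, (Matrix.gram ℝ B).adjugate j i * (inner ℝ (L (B i)) (B j) + inner ℝ (B i) (L (B j))) =
      2 * (Matrix.gram ℝ B).det * LinearMap.trace ℝ V L := by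
  set G := Matrix.gram ℝ B
  set A := LinearMap.toMatrix B B L
  have h1 : ∀ j, L (B j) = ∑ m, A m j • B m := fun j => by
    conv_lhs => rw [← B.sum_repr (L (B j))]
    simp [A, LinearMap.toMatrix_apply]
  have h2 : ∀ i j, inner ℝ (L (B i)) (B j) + inner ℝ (B i) (L (B j)) =
      (A.transpose * G + G * A) i j := fun i j => by
    rw [h1 i, h1 j, sum_inner, inner_sum, Matrix.add_apply, Matrix.mul_apply, Matrix.mul_apply]
    congr 1
    · exact Finset.sum_congr rfl fun m _ => real_inner_smul_left _ _ _
    · exact Finset.sum_congr rfl fun m _ => (real_inner_smul_right _ _ _).trans (mul_comm _ _)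
  have h3 : ∑ i, ∑ j, G.adjugate j i * (A.transpose * G + G * A) i j =
      ((A.transpose * G + G * A) * G.adjugate).trace := by
    simp only [Matrix.trace, Matrix.diag_apply, Matrix.mul_apply (M := A.transpose * G + G * A)]
    exact Finset.sum_congr rfl fun i _ => Finset.sum_congr rfl fun j _ => mul_comm _ _
  simp only [h2]
  rw [h3, add_mul, Matrix.trace_add, mul_assoc, Matrix.mul_adjugate,
    Matrix.trace_mul_comm (G * A), ← mul_assoc, Matrix.adjugate_mul,
    LinearMap.trace_eq_matrix_trace ℝ B L]
  simp only [Matrix.mul_smul, Matrix.smul_mul, mul_one, one_mul, Matrix.trace_smul,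
    Matrix.trace_transpose, smul_eq_mul]
  ring

theorem divergence_eq_trace (X : Π x : M, TangentSpace I x) (x : M) :
    divergence X x =
      LinearMap.trace ℝ (TangentSpace I x) (leviCivita I M X x : TangentSpace I x →ₗ[ℝ] _) := by
  rw [LinearMap.trace_eq_sum_inner _ (frame I x)]
  exact Finset.sum_congr rfl fun i _ => real_inner_comm _ _

section Density

variable {E : Type*} [NormedAddCommGroup E] [NormedSpace ℝ E] [FiniteDimensional ℝ E]
  {M : Type*} [TopologicalSpace M] [ChartedSpace E M] [IsManifold 𝓘(ℝ, E) ∞ M]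
  [RiemannianBundle (fun x : M => TangentSpace 𝓘(ℝ, E) x)]
  [IsContMDiffRiemannianBundle 𝓘(ℝ, E) ∞ E (fun x : M => TangentSpace 𝓘(ℝ, E) x)]
  {ι : Type*} [Fintype ι] [DecidableEq ι] (b : Module.Basis ι ℝ E)
  {p q x : M} {v w : E}

/-- The coordinate vector fields of the chart at `p` form a basis of the tangent spaces. -/
def coordBasis (hx : x ∈ (chartAt E p).source) : Module.Basis ι ℝ (TangentSpace 𝓘(ℝ, E) x) :=
  b.map ((trivializationAt E (TangentSpace 𝓘(ℝ, E)) p).linearEquivAt (R := ℝ) x hx).symm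

theorem coordBasis_apply (hx : x ∈ (chartAt E p).source) (i : ι) :
    coordBasis b hx i = coordField p (b i) x :=
  (Trivialization.symmL_apply (R := ℝ) (trivializationAt E (TangentSpace 𝓘(ℝ, E)) p) hx (b i)).symm

/-- The metric in the chart at `p`. -/
def chartGram (p x : M) : Matrix ι ι ℝ :=
  Matrix.gram ℝ fun i => coordField p (b i) x

/-- The density of the Riemannian volume measure in the chart at `p`. -/
def volumeDensity (p x : M) : ℝ := √(chartGram b p x).det

theorem chartGram_eq (hx : x ∈ (chartAt E p).source) :
    chartGram b p x = Matrix.gram ℝ (coordBasis b hx) := by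
  ext i j
  simp only [chartGram, Matrix.gram_apply, coordBasis_apply]

theorem det_chartGram_pos (hx : x ∈ (chartAt E p).source) : 0 < (chartGram b p x).det := by
  rw [chartGram_eq b hx]
  exact (Matrix.posDef_gram_of_linearIndependent (coordBasis b hx).linearIndependent).det_pos

theorem volumeDensity_pos (hx : x ∈ (chartAt E p).source) : 0 < volumeDensity b p x :=
  Real.sqrt_pos.2 (det_chartGram_pos b hx)

theorem contMDiffAt_det_chartGram (hx : x ∈ (chartAt E p).source) :
    CMDiffAt ∞ (fun y => (chartGram b p y).det) x := by
  simp only [Matrix.det_apply']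
  refine ContMDiffAt.sum fun σ _ => contMDiffAt_const.mul (contMDiffAt_finsetProd fun i _ => ?_)
  exact (smoothAt_coordField hx).inner (smoothAt_coordField hx)

theorem contMDiffAt_volumeDensity (hx : x ∈ (chartAt E p).source) :
    CMDiffAt ∞ (volumeDensity b p) x :=
  (Real.contDiffAt_sqrt (det_chartGram_pos b hx).ne').contMDiffAt.comp x
    (contMDiffAt_det_chartGram b hx)

/-- Coordinate fields commute, so with V = `coordField p v` torsion-freeness gives ∇_V ∂_i = ∇_{∂_i}
V. The derivative of the metric matrix thus has the form in `sum_adjugate_gram_mul` with L = ∇V, and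
tr ∇V = div V. -/
theorem mvfderiv_volumeDensity (hx : x ∈ (chartAt E p).source) :
    mvfderiv 𝓘(ℝ, E) (volumeDensity b p) x (coordField p v x) =
      volumeDensity b p x * divergence (coordField p v) x := by
  have hx' : x ∈ (extChartAt 𝓘(ℝ, E) p).source := by rwa [extChartAt_source]
  have hl := (extChartAt 𝓘(ℝ, E) p).left_inv hx'
  have hd := (contMDiffAt_volumeDensity b hx).mdifferentiableAt (by simp)
  have hs : ∀ u : E, MDiffAt (T% (coordField p u)) x :=
    fun u => (smoothAt_coordField hx).mdifferentiableAt
  have hG : ∀ i j, CMDiffAt ∞ (fun y => chartGram b p y i j) x := fun i j =>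
    (smoothAt_coordField hx).inner (smoothAt_coordField hx)
  have h1 : ∀ i j, fderiv ℝ ((fun y => chartGram b p y i j) ∘ (extChartAt 𝓘(ℝ, E) p).symm)
      (extChartAt 𝓘(ℝ, E) p x) v =
      inner ℝ (leviCivita 𝓘(ℝ, E) M (coordField p v) x (coordBasis b hx i)) (coordBasis b hx j) +
      inner ℝ (coordBasis b hx i)
        (leviCivita 𝓘(ℝ, E) M (coordField p v) x (coordBasis b hx j)) := fun i j => by
    have h2 : ∀ u : E, leviCivita 𝓘(ℝ, E) M (coordField p u) x (coordField p v x) =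
        leviCivita 𝓘(ℝ, E) M (coordField p v) x (coordField p u x) := fun u => by
      rw [← sub_eq_zero, leviCivita_torsion_free (hs v) (hs u), mlieBracket_coordField hx]
    rw [← mvfderiv_coordField hx ((hG i j).mdifferentiableAt (by simp))]
    simp only [coordBasis_apply, ← h2]
    exact leviCivita_metric (hs v) (hs (b i)) (hs (b j))
  have h3 := hasFDerivAt_det (fun i j =>
    ((ContMDiffAt.contDiffAt_comp_extChartAt_symm hx (hG i j)).differentiableAt
      (by simp)).hasFDerivAt)
  have h4 := h3.sqrt (by
    have := det_chartGram_pos b hx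
    rw [← hl] at this
    exact this.ne')
  rw [mvfderiv_coordField hx hd]
  refine (congrArg (fun L => L v) h4.fderiv).trans ?_
  have h5 := sum_adjugate_gram_mul (coordBasis b hx)
    (leviCivita 𝓘(ℝ, E) M (coordField p v) x : TangentSpace 𝓘(ℝ, E) x →ₗ[ℝ] _)
  simp only [ContinuousLinearMap.coe_coe, ← h1] at h5
  rw [← chartGram_eq, ← divergence_eq_trace] at h5
  have h6 : volumeDensity b p x ^ 2 = (chartGram b p x).det :=
    Real.sq_sqrt (det_chartGram_pos b hx).le
  have h7 := (volumeDensity_pos b hx).ne'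
  simp only [smul_apply, sum_apply, smul_eq_mul]
  simp only [Function.comp_apply, hl]
  change 1 / (2 * volumeDensity b p x) * (∑ i, ∑ j, (chartGram b p x).adjugate j i * _) = _
  rw [h5, ← h6]
  field_simp

/-- The density absorbs the divergence of the coordinate field, so the product is an honest partial
derivative that Euclidean integration can kill. -/
theorem divergence_smul_coordField {f : M → ℝ} (hx : x ∈ (chartAt E p).source)
    (hf : MDiffAt f x) :
    divergence (f • coordField p v) x * volumeDensity b p x =
      fderiv ℝ ((fun y => f y * volumeDensity b p y) ∘ (extChartAt 𝓘(ℝ, E) p).symm)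
        (extChartAt 𝓘(ℝ, E) p x) v := by
  have hd := (contMDiffAt_volumeDensity b hx).mdifferentiableAt (by simp)
  rw [← mvfderiv_coordField (F := fun y => f y * volumeDensity b p y) hx (hf.mul hd),
    divergence_smul hf (smoothAt_coordField hx).mdifferentiableAt]
  have := mvfderiv_fun_mul hf hd
  rw [this, add_apply, smul_apply, smul_apply, mvfderiv_volumeDensity b hx, smul_eq_mul,
    smul_eq_mul]
  ring

end Density

/-! ### Integration in one chart. -/

theorem divergence_zero (x : M) : divergence (0 : Π x : M, TangentSpace I x) x = 0 := by
  have h0 : SmoothAt (0 : Π x : M, TangentSpace I x) x := contMDiffAt_zeroSection _ _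
  have h := divergence_add h0.mdifferentiableAt h0.mdifferentiableAt
  rw [add_zero] at h
  linarith

theorem divergence_sum {ι : Type*} (s : Finset ι) {X : ι → Π x : M, TangentSpace I x} {x : M}
    (hX : ∀ i ∈ s, SmoothAt (X i) x) :
    divergence (∑ i ∈ s, X i) x = ∑ i ∈ s, divergence (X i) x := by
  classical
  induction s using Finset.induction_on with
  | empty => exact divergence_zero x
  | insert a s ha ih =>
    have h1 := hX a (Finset.mem_insert_self a s)
    have h2 := fun i hi => hX i (Finset.mem_insert_of_mem (a := i) (b := a) hi)
    have h3 : SmoothAt (∑ i ∈ s, X i) x :=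
      (SmoothAt.sum h2).congr (.of_eq (by ext1 y; exact Finset.sum_apply y s X))
    rw [Finset.sum_insert ha, Finset.sum_insert ha,
      divergence_add h1.mdifferentiableAt h3.mdifferentiableAt, ih h2]

theorem tsupport_divergence_smul_subset (χ : M → ℝ) (W : Π x : M, TangentSpace I x) :
    tsupport (divergence (χ • W)) ⊆ tsupport χ := by
  refine closure_minimal (fun x hx => ?_) (isClosed_tsupport χ)
  by_contra hx'
  refine hx ?_
  rw [← divergence_zero (I := I) x]
  refine divergence_congr (contMDiffAt_zeroSection ℝ (TangentSpace I : M → Type _) (n := ∞)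
    |>.mdifferentiableAt (by simp)) ?_
  filter_upwards [notMem_tsupport_iff_eventuallyEq.1 hx'] with y hy
  exact (congrArg (· • W y) hy).trans (zero_smul ℝ (W y))

section ChartIntegral

variable {E : Type*} [NormedAddCommGroup E] [NormedSpace ℝ E] [FiniteDimensional ℝ E]
  {M : Type*} [TopologicalSpace M] [ChartedSpace E M]

/-- The function `g` in the chart at `p`, extended by zero outside of the chart. -/
def chartPush (p : M) (g : M → ℝ) : E → ℝ :=
  (extChartAt 𝓘(ℝ, E) p).target.indicator (g ∘ (extChartAt 𝓘(ℝ, E) p).symm)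

variable {p q : M} {g : M → ℝ}

theorem chartPush_eventuallyEq {y : E} (hy : y ∈ (extChartAt 𝓘(ℝ, E) p).target) :
    chartPush p g =ᶠ[𝓝 y] g ∘ (extChartAt 𝓘(ℝ, E) p).symm := by
  filter_upwards [(isOpen_extChartAt_target p).mem_nhds hy] with z hz
  exact indicator_of_mem hz _

theorem support_chartPush_subset :
    Function.support (chartPush (E := E) p g) ⊆ extChartAt 𝓘(ℝ, E) p '' tsupport g := by
  intro y hy
  have h1 : y ∈ (extChartAt 𝓘(ℝ, E) p).target := by
    by_contra h
    exact hy (indicator_of_notMem h _)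
  refine ⟨(extChartAt 𝓘(ℝ, E) p).symm y, subset_tsupport _ ?_, (extChartAt 𝓘(ℝ, E) p).right_inv h1⟩
  rwa [Function.mem_support, chartPush, indicator_of_mem h1] at hy

theorem isCompact_image_tsupport [CompactSpace M] (hg : tsupport g ⊆ (chartAt E p).source) :
    IsCompact (extChartAt 𝓘(ℝ, E) p '' tsupport g) :=
  (isClosed_tsupport g).isCompact.image_of_continuousOn
    ((continuousOn_extChartAt p).mono (by rwa [extChartAt_source]))

theorem hasCompactSupport_chartPush [CompactSpace M] (hg : tsupport g ⊆ (chartAt E p).source) :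
    HasCompactSupport (chartPush (E := E) p g) :=
  .of_support_subset_isCompact (isCompact_image_tsupport hg) support_chartPush_subset

/-- The image of the support is compact, hence closed, and lies inside the chart target. This is why
extension by zero stays smooth. -/
theorem chartPush_eventuallyEq_zero [CompactSpace M] (hg : tsupport g ⊆ (chartAt E p).source)
    {y : E} (hy : y ∉ (extChartAt 𝓘(ℝ, E) p).target) : chartPush p g =ᶠ[𝓝 y] 0 := by
  have h1 : y ∉ extChartAt 𝓘(ℝ, E) p '' tsupport g := by
    rintro ⟨x, hx, rfl⟩
    exact hy ((extChartAt 𝓘(ℝ, E) p).map_source (by rw [extChartAt_source]; exact hg hx))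
  filter_upwards [(isCompact_image_tsupport hg).isClosed.isOpen_compl.mem_nhds h1] with z hz
  by_contra h
  exact hz (support_chartPush_subset h)

variable [IsManifold 𝓘(ℝ, E) ∞ M]

theorem contDiff_chartPush [CompactSpace M] (hg : tsupport g ⊆ (chartAt E p).source)
    (hs : ∀ x ∈ (chartAt E p).source, CMDiffAt ∞ g x) :
    ContDiff ℝ ∞ (chartPush (E := E) p g) := by
  refine contDiff_iff_contDiffAt.2 fun y => ?_
  by_cases hy : y ∈ (extChartAt 𝓘(ℝ, E) p).target
  · have hx := (extChartAt 𝓘(ℝ, E) p).map_target hy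
    rw [extChartAt_source] at hx
    have h := ContMDiffAt.contDiffAt_comp_extChartAt_symm hx (hs _ hx)
    rw [(extChartAt 𝓘(ℝ, E) p).right_inv hy] at h
    exact h.congr_of_eventuallyEq (chartPush_eventuallyEq hy)
  · exact contDiffAt_const.congr_of_eventuallyEq (chartPush_eventuallyEq_zero hg hy)

/-- Integration by parts against the constant function 1. -/
theorem integral_fderiv_eq_zero [MeasurableSpace E] [BorelSpace E] (μ : MeasureTheory.Measure E)
    [μ.IsAddHaarMeasure] {u : E → ℝ} (hu : ContDiff ℝ ∞ u) (hc : HasCompactSupport u) (v : E) :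
    ∫ y, fderiv ℝ u y v ∂μ = 0 := by
  have hu' : Continuous fun y => fderiv ℝ u y v :=
    (hu.continuous_fderiv (by simp)).clm_apply continuous_const
  have h := integral_mul_fderiv_eq_neg_fderiv_mul_of_integrable (μ := μ) (f := fun _ : E => (1 : ℝ))
    (g := u) (v := v) (by simp) 
    (by simpa using hu'.integrable_of_hasCompactSupport (hc.fderiv_apply ℝ v))
    (by simpa using hu.continuous.integrable_of_hasCompactSupport hc)
    (fun _ _ => differentiableAt_const _) (fun _ _ => hu.differentiable (by simp) _)
  simpa using h

variable
  [RiemannianBundle (fun x : M => TangentSpace 𝓘(ℝ, E) x)]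
  [IsContMDiffRiemannianBundle 𝓘(ℝ, E) ∞ E (fun x : M => TangentSpace 𝓘(ℝ, E) x)]
  [MeasurableSpace E] [BorelSpace E] (μ : MeasureTheory.Measure E) [μ.IsAddHaarMeasure]
  {ι : Type*} [Fintype ι] [DecidableEq ι] (b : Module.Basis ι ℝ E)

/-- The integral over the domain of the chart at `p`, with respect to the Riemannian volume. -/
def chartIntegral (p : M) (F : M → ℝ) : ℝ :=
  ∫ y, chartPush p (fun x => F x * volumeDensity b p x) y ∂μ

theorem tsupport_mul_volumeDensity_subset (p : M) (F : M → ℝ) :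
    tsupport (fun x => F x * volumeDensity b p x) ⊆ tsupport F :=
  tsupport_mul_subset_left

variable {F : M → ℝ}

theorem integrable_chartPush [CompactSpace M] (hF : tsupport F ⊆ (chartAt E p).source)
    (hs : CMDiff ∞ F) :
    MeasureTheory.Integrable (chartPush p (fun x => F x * volumeDensity b p x)) μ :=
  have hF' := (tsupport_mul_volumeDensity_subset b p F).trans hF
  (contDiff_chartPush hF' fun x hx => (hs x).mul
    (contMDiffAt_volumeDensity b hx)).continuous.integrable_of_hasCompactSupport
    (hasCompactSupport_chartPush hF')

theorem chartIntegral_sum [CompactSpace M] {κ : Type*} (s : Finset κ) {F : κ → M → ℝ}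
    (hF : ∀ i ∈ s, tsupport (F i) ⊆ (chartAt E p).source) (hs : ∀ i ∈ s, CMDiff ∞ (F i)) :
    chartIntegral μ b p (fun x => ∑ i ∈ s, F i x) = ∑ i ∈ s, chartIntegral μ b p (F i) := by
  simp only [chartIntegral]
  rw [← MeasureTheory.integral_finsetSum s fun i hi => integrable_chartPush μ b (hF i hi) (hs i hi)]
  congr 1
  ext y
  by_cases hy : y ∈ (extChartAt 𝓘(ℝ, E) p).target
  · simp only [chartPush, indicator_of_mem hy, Function.comp_apply, Finset.sum_mul]
  · simp only [chartPush, indicator_of_notMem hy, Finset.sum_const_zero]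

theorem chartIntegral_pos [CompactSpace M] (hF : tsupport F ⊆ (chartAt E p).source)
    (hs : CMDiff ∞ F) (h0 : ∀ x, 0 ≤ F x) {x : M} (hx : F x ≠ 0) : 0 < chartIntegral μ b p F := by
  have hF' := (tsupport_mul_volumeDensity_subset b p F).trans hF
  have hxs := hF (subset_tsupport _ hx)
  refine (contDiff_chartPush hF' fun x hx => (hs x).mul
    (contMDiffAt_volumeDensity b hx)).continuous.integral_pos_of_hasCompactSupport_nonneg_nonzero
    (x := extChartAt 𝓘(ℝ, E) p x) (hasCompactSupport_chartPush hF') ?_ ?_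
  · exact fun y => indicator_nonneg (fun _ _ => mul_nonneg (h0 _) (Real.sqrt_nonneg _)) y
  · have hx' : x ∈ (extChartAt 𝓘(ℝ, E) p).source := by rwa [extChartAt_source]
    rw [chartPush, indicator_of_mem ((extChartAt 𝓘(ℝ, E) p).map_source hx'), Function.comp_apply,
      (extChartAt 𝓘(ℝ, E) p).left_inv hx']
    exact mul_ne_zero hx (volumeDensity_pos b hxs).ne'

theorem chartIntegral_nonneg (h0 : ∀ x, 0 ≤ F x) : 0 ≤ chartIntegral μ b p F :=
  MeasureTheory.integral_nonneg
    fun y => indicator_nonneg (fun _ _ => mul_nonneg (h0 _) (Real.sqrt_nonneg _)) y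

end ChartIntegral

/-! ### The divergence theorem in a chart and independence of the chart. -/

section ChartDivergence

variable {E : Type*} [NormedAddCommGroup E] [NormedSpace ℝ E] [FiniteDimensional ℝ E]
  {M : Type*} [TopologicalSpace M] [ChartedSpace E M] [IsManifold 𝓘(ℝ, E) ∞ M]
  {ι : Type*} [Fintype ι] (b : Module.Basis ι ℝ E) {p q x : M}

/-- The components of a vector field in the chart at `p`. -/
def coordCoeff (p : M) (W : Π x : M, TangentSpace 𝓘(ℝ, E) x) (k : ι) (x : M) : ℝ :=
  b.repr ((trivializationAt E (TangentSpace 𝓘(ℝ, E)) p).continuousLinearMapAt ℝ x (W x)) k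

variable {W : Π x : M, TangentSpace 𝓘(ℝ, E) x}

theorem contMDiffAt_coordCoeff (hx : x ∈ (chartAt E p).source) (hW : SmoothAt W x) (k : ι) :
    CMDiffAt ∞ (coordCoeff b p W k) x := by
  have hb : (trivializationAt E (TangentSpace 𝓘(ℝ, E)) p).baseSet ∈ 𝓝 x :=
    (chartAt E p).open_source.mem_nhds hx
  have h := ((trivializationAt E (TangentSpace 𝓘(ℝ, E)) p).contMDiffAt_section_iff
    (IB := 𝓘(ℝ, E)) (n := ∞) (s := W) hx).1 hW
  have h2 : CMDiffAt ∞ (fun y => (b.coord k).toContinuousLinearMap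
      ((trivializationAt E (TangentSpace 𝓘(ℝ, E)) p) (W y)).2) x :=
    ((b.coord k).toContinuousLinearMap.contDiff.contMDiff.contMDiffAt).comp x h
  refine h2.congr_of_eventuallyEq ?_
  filter_upwards [hb] with y hy
  rw [coordCoeff, (trivializationAt E (TangentSpace 𝓘(ℝ, E)) p).continuousLinearMapAt_apply_of_mem
    ℝ hy]
  rfl

theorem sum_coordCoeff_smul (hx : x ∈ (chartAt E p).source) :
    ∑ k, coordCoeff b p W k x • coordField p (b k) x = W x := by
  have h := (trivializationAt E (TangentSpace 𝓘(ℝ, E)) p).symmL_continuousLinearMapAt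
    (R := ℝ) (b := x) hx (W x)
  conv_rhs => rw [← h, ← b.sum_repr
    ((trivializationAt E (TangentSpace 𝓘(ℝ, E)) p).continuousLinearMapAt ℝ x (W x)), map_sum]
  exact Finset.sum_congr rfl fun k _ => (map_smul _ _ _).symm

variable [DecidableEq ι]
  [RiemannianBundle (fun x : M => TangentSpace 𝓘(ℝ, E) x)]
  [IsContMDiffRiemannianBundle 𝓘(ℝ, E) ∞ E (fun x : M => TangentSpace 𝓘(ℝ, E) x)]
  [MeasurableSpace E] [BorelSpace E] (μ : MeasureTheory.Measure E) [μ.IsAddHaarMeasure]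

/-- Expanded in coordinate fields, the integrand becomes a sum of partial derivatives of smooth
compactly supported functions. -/
theorem chartIntegral_divergence_smul [CompactSpace M] {χ : M → ℝ} (hW : ∀ x, SmoothAt W x)
    (hχ : CMDiff ∞ χ) (hs : tsupport χ ⊆ (chartAt E p).source) :
    chartIntegral μ b p (divergence (χ • W)) = 0 := by
  set f : ι → M → ℝ := fun k x => χ x * coordCoeff b p W k x
  set g : ι → M → ℝ := fun k x => f k x * volumeDensity b p x
  have hf : ∀ k, ∀ x ∈ (chartAt E p).source, CMDiffAt ∞ (f k) x := fun k x hx =>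
    (hχ x).mul (contMDiffAt_coordCoeff b hx (hW x) k)
  have hg : ∀ k, ∀ x ∈ (chartAt E p).source, CMDiffAt ∞ (g k) x := fun k x hx =>
    (hf k x hx).mul (contMDiffAt_volumeDensity b hx)
  have hgs : ∀ k, tsupport (g k) ⊆ (chartAt E p).source := fun k =>
    (tsupport_mul_volumeDensity_subset b p (f k)).trans ((tsupport_mul_subset_left).trans hs)
  have hu := fun k => contDiff_chartPush (hgs k) (hg k)
  have huc := fun k => hasCompactSupport_chartPush (hgs k)
  have hd : ∀ x ∈ (chartAt E p).source, divergence (χ • W) x * volumeDensity b p x =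
      ∑ k, fderiv ℝ (g k ∘ (extChartAt 𝓘(ℝ, E) p).symm) (extChartAt 𝓘(ℝ, E) p x) (b k) := by
    intro x hx
    set X : ι → Π x : M, TangentSpace 𝓘(ℝ, E) x := fun k => f k • coordField p (b k)
    have h1 : ∀ k, SmoothAt (X k) x := fun k =>
      SmoothAt.smul (hf k x hx) (smoothAt_coordField hx)
    have h2 : SmoothAt (χ • W) x := SmoothAt.smul (hχ x) (hW x)
    let Z : Π x : M, TangentSpace 𝓘(ℝ, E) x := ∑ k, X k
    have h3 : Z =ᶠ[𝓝 x] χ • W := by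
      filter_upwards [(chartAt E p).open_source.mem_nhds hx] with y hy
      refine (Finset.sum_apply y Finset.univ X).trans ?_
      change ∑ k, (χ y * coordCoeff b p W k y) • coordField p (b k) y = χ y • W y
      rw [← sum_coordCoeff_smul b (W := W) hy, Finset.smul_sum]
      exact Finset.sum_congr rfl fun k _ => mul_smul _ _ _
    rw [← divergence_congr h2.mdifferentiableAt h3, divergence_sum Finset.univ fun k _ => h1 k,
      Finset.sum_mul]
    exact Finset.sum_congr rfl fun k _ => divergence_smul_coordField b hx
      ((hf k x hx).mdifferentiableAt (by simp))
  have hp : chartPush p (fun x => divergence (χ • W) x * volumeDensity b p x) =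
      fun y => ∑ k, fderiv ℝ (chartPush p (g k)) y (b k) := by
    ext y
    by_cases hy : y ∈ (extChartAt 𝓘(ℝ, E) p).target
    · have hx := (extChartAt 𝓘(ℝ, E) p).map_target hy
      rw [extChartAt_source] at hx
      rw [chartPush, indicator_of_mem hy, Function.comp_apply, hd _ hx,
        (extChartAt 𝓘(ℝ, E) p).right_inv hy]
      exact Finset.sum_congr rfl fun k _ => by rw [(chartPush_eventuallyEq hy).fderiv_eq]
    · rw [chartPush, indicator_of_notMem hy]
      refine (Finset.sum_eq_zero fun k _ => ?_).symm
      rw [(chartPush_eventuallyEq_zero (hgs k) hy).fderiv_eq]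
      simp
  rw [chartIntegral, hp, MeasureTheory.integral_finsetSum]
  · exact Finset.sum_eq_zero fun k _ => integral_fderiv_eq_zero μ (hu k) (huc k) (b k)
  · exact fun k _ => Continuous.integrable_of_hasCompactSupport
      (((hu k).continuous_fderiv (by simp)).clm_apply continuous_const) ((huc k).fderiv_apply ℝ _)

theorem coordField_eq_coordField_tangentCoordChange {v : E} (hp : x ∈ (chartAt E p).source)
    (hq : x ∈ (chartAt E q).source) :
    coordField p v x = coordField q (tangentCoordChange 𝓘(ℝ, E) p q x v) x := by
  rw [coordField, coordField, TangentBundle.symmL_trivializationAt_eq_core hp,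
    TangentBundle.symmL_trivializationAt_eq_core hq]
  refine (tangentCoordChange_comp (I := 𝓘(ℝ, E)) (w := p) (x := q) (y := x) (z := x) (v := v)
    ⟨⟨?_, ?_⟩, mem_extChartAt_source x⟩).symm
  · rwa [extChartAt_source]
  · rwa [extChartAt_source]

/-- The two metric matrices are congruent through the Jacobian matrix of the transition map. -/
theorem volumeDensity_eq_abs_det_mul (hp : x ∈ (chartAt E p).source)
    (hq : x ∈ (chartAt E q).source) :
    volumeDensity b p x = |(tangentCoordChange 𝓘(ℝ, E) p q x).det| * volumeDensity b q x := by
  set D := tangentCoordChange 𝓘(ℝ, E) p q x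
  set A := LinearMap.toMatrix b b (D : E →ₗ[ℝ] E)
  have h1 : ∀ k, coordField p (b k) x = ∑ m, A m k • coordField q (b m) x := fun k => by
    have h2 : D (b k) = ∑ m, A m k • b m := by
      conv_lhs => rw [← b.sum_repr (D (b k))]
      simp [A, LinearMap.toMatrix_apply]
    rw [coordField_eq_coordField_tangentCoordChange hp hq]
    change coordField q (D (b k)) x = _
    rw [h2, coordField, map_sum]
    exact Finset.sum_congr rfl fun m _ => map_smul _ _ _
  have h2 : chartGram b p x = A.transpose * chartGram b q x * A := by
    ext i j
    rw [mul_assoc, chartGram, Matrix.gram_apply, h1 i, h1 j, sum_inner]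
    simp only [inner_sum, Matrix.mul_apply, real_inner_smul_left, real_inner_smul_right,
      Finset.mul_sum, Matrix.transpose_apply, chartGram, Matrix.gram_apply]
    exact Finset.sum_congr rfl fun k _ => Finset.sum_congr rfl fun l _ => by ring
  have h3 : (chartGram b p x).det = D.det ^ 2 * (chartGram b q x).det := by
    rw [h2, Matrix.det_mul, Matrix.det_mul, Matrix.det_transpose, LinearMap.det_toMatrix]
    change LinearMap.det (D : E →ₗ[ℝ] E) * _ * LinearMap.det (D : E →ₗ[ℝ] E) =
      LinearMap.det (D : E →ₗ[ℝ] E) ^ 2 * _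
    ring
  rw [volumeDensity, h3, Real.sqrt_mul (sq_nonneg _), Real.sqrt_sq_eq_abs, volumeDensity]

/-- Both integrals live on the overlap of the charts, where the Jacobian of the change of variables
is exactly the ratio of the densities. -/
theorem chartIntegral_eq {F : M → ℝ} (hp : ∀ x, F x ≠ 0 → x ∈ (chartAt E p).source)
    (hq : ∀ x, F x ≠ 0 → x ∈ (chartAt E q).source) :
    chartIntegral μ b p F = chartIntegral μ b q F := by
  set φ := extChartAt 𝓘(ℝ, E) p
  set ψ := extChartAt 𝓘(ℝ, E) q
  have hsp : φ.source = (chartAt E p).source := extChartAt_source _ _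
  have hsq : ψ.source = (chartAt E q).source := extChartAt_source _ _
  set U := φ.source ∩ ψ.source
  have key : ∀ (r : M) (hr : ∀ x, F x ≠ 0 → x ∈ (chartAt E r).source)
      (hU : U ⊆ (extChartAt 𝓘(ℝ, E) r).source),
      chartIntegral μ b r F = ∫ y in extChartAt 𝓘(ℝ, E) r '' U,
        F ((extChartAt 𝓘(ℝ, E) r).symm y) * volumeDensity b r ((extChartAt 𝓘(ℝ, E) r).symm y)
          ∂μ := by
    intro r hr hU
    have ho : IsOpen (extChartAt 𝓘(ℝ, E) r '' U) :=
      (chartAt E r).isOpen_image_of_subset_source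
        ((isOpen_extChartAt_source p).inter (isOpen_extChartAt_source q))
        (by rwa [extChartAt_source] at hU)
    rw [chartIntegral, ← MeasureTheory.integral_indicator ho.measurableSet]
    congr 1
    ext y
    by_cases hy : y ∈ extChartAt 𝓘(ℝ, E) r '' U
    · have hy' : y ∈ (extChartAt 𝓘(ℝ, E) r).target := by
        obtain ⟨x, hx, rfl⟩ := hy
        exact (extChartAt 𝓘(ℝ, E) r).map_source (hU hx)
      rw [indicator_of_mem hy, chartPush, indicator_of_mem hy', Function.comp_apply]
    · rw [indicator_of_notMem hy, chartPush, indicator_apply_eq_zero]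
      intro hy'
      have h0 : F ((extChartAt 𝓘(ℝ, E) r).symm y) = 0 := by
        by_contra h
        refine hy ⟨_, ⟨?_, ?_⟩, (extChartAt 𝓘(ℝ, E) r).right_inv hy'⟩
        · exact hsp ▸ hp _ h
        · exact hsq ▸ hq _ h
      rw [Function.comp_apply, h0, zero_mul]
  have himg : (ψ ∘ φ.symm) '' (φ '' U) = ψ '' U := by
    rw [image_image]
    exact image_congr fun x hx => congrArg ψ (φ.left_inv hx.1)
  have hinj : InjOn (ψ ∘ φ.symm) (φ '' U) := by
    rintro _ ⟨x, hx, rfl⟩ _ ⟨y, hy, rfl⟩ h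
    rw [Function.comp_apply, Function.comp_apply, φ.left_inv hx.1, φ.left_inv hy.1] at h
    rw [ψ.injOn hx.2 hy.2 h]
  have hder : ∀ y ∈ φ '' U, HasFDerivWithinAt (ψ ∘ φ.symm)
      (tangentCoordChange 𝓘(ℝ, E) p q (φ.symm y)) (φ '' U) y := by
    rintro _ ⟨x, hx, rfl⟩
    rw [φ.left_inv hx.1]
    exact (hasFDerivWithinAt_tangentCoordChange hx).mono
      (by rw [modelWithCornersSelf_coe, range_id]; exact subset_univ _)
  have ho : IsOpen (φ '' U) := (chartAt E p).isOpen_image_of_subset_source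
    ((isOpen_extChartAt_source p).inter (isOpen_extChartAt_source q)) (hsp ▸ inter_subset_left)
  rw [key p hp inter_subset_left, key q hq inter_subset_right, ← himg,
    MeasureTheory.integral_image_eq_integral_abs_det_fderiv_smul μ ho.measurableSet hder hinj]
  refine MeasureTheory.setIntegral_congr_fun ho.measurableSet ?_
  rintro _ ⟨x, hx, rfl⟩
  simp only [Function.comp_apply]
  rw [φ.left_inv hx.1, ψ.left_inv hx.2,
    volumeDensity_eq_abs_det_mul b (hsp ▸ hx.1) (hsq ▸ hx.2), smul_eq_mul]
  ring

end ChartDivergence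

/-! ### The global divergence theorem. -/

section DivergenceTheorem

variable {E : Type*} [NormedAddCommGroup E] [NormedSpace ℝ E] [FiniteDimensional ℝ E]
  {M : Type*} [TopologicalSpace M] [ChartedSpace E M] [IsManifold 𝓘(ℝ, E) ∞ M]
  [RiemannianBundle (fun x : M => TangentSpace 𝓘(ℝ, E) x)]
  [IsContMDiffRiemannianBundle 𝓘(ℝ, E) ∞ E (fun x : M => TangentSpace 𝓘(ℝ, E) x)]

/-- On a compact manifold without boundary, the divergence of a smooth vector field cannot be
nonnegative without vanishing: its integral is zero. -/
theorem divergence_eq_zero_of_nonneg [CompactSpace M] [T2Space M]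
    {W : Π x : M, TangentSpace 𝓘(ℝ, E) x} (hW : ∀ x, SmoothAt W x)
    (h0 : ∀ x, 0 ≤ divergence W x) (x : M) : divergence W x = 0 := by
  classical
  let : MeasurableSpace E := borel E
  have : BorelSpace E := ⟨rfl⟩
  let μ : MeasureTheory.Measure E := MeasureTheory.Measure.addHaar
  let b := Module.finBasis ℝ E
  obtain ⟨t, ht⟩ := isCompact_univ.elim_finite_subcover (fun p : M => (chartAt E p).source)
    (fun p => (chartAt E p).open_source)
    (fun y _ => mem_iUnion_of_mem y (mem_chart_source E y))
  obtain ⟨ρ, hρ⟩ := SmoothPartitionOfUnity.exists_isSubordinate 𝓘(ℝ, E) (s := (univ : Set M))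
    isClosed_univ (fun p : t => (chartAt E (p : M)).source) (fun p => (chartAt E (p : M)).open_source)
    (by simpa [iUnion_subtype] using ht)
  have hsum : ∀ y, ∑ i, ρ i y = 1 := fun y => by
    rw [← finsum_eq_sum_of_fintype]
    exact ρ.sum_eq_one (mem_univ y)
  have hρs : ∀ i, CMDiff ∞ (ρ i : M → ℝ) := fun i => (ρ i).contMDiff
  have hd : ∀ i, CMDiff ∞ (divergence ((ρ i : M → ℝ) • W)) := fun i y =>
    contMDiffAt_divergence (SmoothAt.smul (hρs i y) (hW y))
  have hdW : CMDiff ∞ (divergence W) := fun y => contMDiffAt_divergence (hW y)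
  have hts : ∀ i, tsupport (divergence ((ρ i : M → ℝ) • W)) ⊆ (chartAt E (i : M)).source :=
    fun i => (tsupport_divergence_smul_subset _ _).trans (hρ i)
  have hdiv : ∀ y, divergence W y = ∑ j, divergence ((ρ j : M → ℝ) • W) y := fun y => by
    have h1 : ∑ j, (ρ j : M → ℝ) • W = W := by
      ext1 z
      refine (Finset.sum_apply z Finset.univ _).trans ?_
      change ∑ j, ρ j z • W z = W z
      rw [← Finset.sum_smul, hsum, one_smul]
    rw [← divergence_sum Finset.univ fun j _ => SmoothAt.smul (hρs j y) (hW y), h1]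
  have hnn : ∀ i : t, 0 ≤ chartIntegral μ b (i : M) (fun y => ρ i y * divergence W y) := fun i =>
    chartIntegral_nonneg μ b fun y => mul_nonneg (ρ.nonneg i y) (h0 y)
  have hmul : ∀ i j : t, CMDiff ∞ (fun y => ρ i y * divergence ((ρ j : M → ℝ) • W) y) := fun i j =>
    (hρs i).mul (hd j)
  -- The field is cut up by the same partition. The term ρ_i div(ρ_j W) is supported in both charts,
  -- so its integral may be moved from chart i to chart j.
  have h1 : ∀ i : t, chartIntegral μ b (i : M) (fun y => ρ i y * divergence W y) =
      ∑ j : t, chartIntegral μ b (j : M) (fun y => ρ i y * divergence ((ρ j : M → ℝ) • W) y) := by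
    intro i
    simp only [hdiv, Finset.mul_sum]
    rw [chartIntegral_sum μ b _ (fun j _ => tsupport_mul_subset_left.trans (hρ i))
      fun j _ => hmul i j]
    refine Finset.sum_congr rfl fun j _ => chartIntegral_eq b μ (fun y hy => ?_) fun y hy => ?_
    · exact hρ i (subset_tsupport _ (left_ne_zero_of_mul hy))
    · exact hts j (subset_tsupport _ (right_ne_zero_of_mul hy))
  have h2 : ∑ i : t, chartIntegral μ b (i : M) (fun y => ρ i y * divergence W y) = 0 := by
    simp only [h1]
    -- Summing over i first restores Σ ρ_i = 1 and leaves, in chart j, the divergence of a field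
    -- supported there.
    rw [Finset.sum_comm]
    refine Finset.sum_eq_zero fun j _ => ?_
    rw [← chartIntegral_sum μ b _ (fun i _ => tsupport_mul_subset_right.trans (hts j))
      fun i _ => hmul i j]
    simp only [← Finset.sum_mul, hsum, one_mul]
    exact chartIntegral_divergence_smul b μ hW (hρs j) (hρ j)
  -- If the divergence were nonzero at `x`, then some ρ_i with ρ_i(x) ≠ 0 would give a positive term
  -- in a vanishing sum of nonnegative ones.
  by_contra hx
  obtain ⟨i, -, hi⟩ := Finset.exists_ne_zero_of_sum_ne_zero ((hsum x).trans_ne one_ne_zero)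
  have h3 := (Finset.sum_eq_zero_iff_of_nonneg fun i _ => hnn i).1 h2 i (Finset.mem_univ i)
  exact (chartIntegral_pos μ b (tsupport_mul_subset_left.trans (hρ i)) ((hρs i).mul hdW)
    (fun y => mul_nonneg (ρ.nonneg i y) (h0 y)) (mul_ne_zero hi hx)).ne' h3

end DivergenceTheorem

/-! ### Rigidity of the soliton. -/

theorem symmForm_eq_zero {X : Π x : M, TangentSpace I x} {x : M} {ι : Type*} [Fintype ι]
    {b : OrthonormalBasis ι ℝ (TangentSpace I x)}
    (h : ∀ i j, symmForm X x (b i) (b j) = 0) (v w : TangentSpace I x) : symmForm X x v w = 0 := by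
  have h1 : nablaForm X x + (nablaForm X x).flip = 0 := by
    refine LinearMap.ext_basis b.toBasis b.toBasis fun i j => ?_
    have h2 := h i j
    rw [symmForm] at h2
    rw [b.coe_toBasis, LinearMap.add_apply, LinearMap.add_apply, LinearMap.flip_apply,
      nablaForm_apply, nablaForm_apply, real_inner_comm (b i)]
    change _ = (0 : ℝ)
    linarith
  have h2 := congrArg (fun B => B v w) h1
  rw [symmForm, real_inner_comm _ v]
  simp only [LinearMap.add_apply, LinearMap.flip_apply, nablaForm_apply, LinearMap.zero_apply] at h2
  rw [h2, zero_div]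

theorem lieDerivMetric_eq_two_mul_symmForm {X Y Z : Π x : M, TangentSpace I x} {x : M}
    (hX : MDiffAt (T% X) x) (hY : MDiffAt (T% Y) x) (hZ : MDiffAt (T% Z) x) :
    lieDerivMetric X Y Z x = 2 * symmForm X x (Y x) (Z x) := by
  rw [lieDerivMetric_eq hX hY hZ, symmForm]
  ring

section Main

variable {E : Type*} [NormedAddCommGroup E] [NormedSpace ℝ E] [FiniteDimensional ℝ E]
  {M : Type*} [TopologicalSpace M] [ChartedSpace E M] [IsManifold 𝓘(ℝ, E) ∞ M]

/-- On a ball in a chart the Euclidean derivative vanishes, so f is locally constant, and M is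
connected. -/
theorem exists_eq_const_of_mvfderiv_eq_zero [ConnectedSpace M] {f : M → ℝ} (hf : CMDiff ∞ f)
    (h : ∀ x, mvfderiv 𝓘(ℝ, E) f x = 0) : ∃ c, ∀ x, f x = c := by
  have hl : IsLocallyConstant f := by
    refine (IsLocallyConstant.iff_eventually_eq f).2 fun x => ?_
    set φ := extChartAt 𝓘(ℝ, E) x
    obtain ⟨ε, hε, hb⟩ := Metric.isOpen_iff.1 (isOpen_extChartAt_target (I := 𝓘(ℝ, E)) x) (φ x)
      (mem_extChartAt_target x)
    have hsrc : ∀ y ∈ Metric.ball (φ x) ε, φ.symm y ∈ (chartAt E x).source := fun y hy => by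
      have := φ.map_target (hb hy)
      rwa [extChartAt_source] at this
    have hd : DifferentiableOn ℝ (f ∘ φ.symm) (Metric.ball (φ x) ε) := fun y hy => by
      have := ContMDiffAt.contDiffAt_comp_extChartAt_symm (hsrc y hy) (hf _)
      rw [φ.right_inv (hb hy)] at this
      exact (this.differentiableAt (by simp)).differentiableWithinAt
    have h0 : EqOn (fderiv ℝ (f ∘ φ.symm)) 0 (Metric.ball (φ x) ε) := fun y hy => by
      ext v
      have := mvfderiv_coordField (v := v) (hsrc y hy) (hf.mdifferentiable (by simp) _)
      rw [φ.right_inv (hb hy), h] at this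
      exact this.symm
    have hn : φ.source ∩ φ ⁻¹' Metric.ball (φ x) ε ∈ 𝓝 x :=
      Filter.inter_mem (extChartAt_source_mem_nhds x)
        ((continuousAt_extChartAt x).preimage_mem_nhds (Metric.ball_mem_nhds _ hε))
    filter_upwards [hn] with y hy
    have := Metric.isOpen_ball.is_const_of_fderiv_eq_zero
      (convex_ball (φ x) ε).isPreconnected hd h0 hy.2 (Metric.mem_ball_self hε)
    rwa [Function.comp_apply, Function.comp_apply, φ.left_inv hy.1,
      φ.left_inv (mem_extChartAt_source x)] at this
  exact ⟨f (Classical.arbitrary M), fun x => hl.apply_eq_of_preconnectedSpace _ _⟩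

variable {ξ : Π x : M, TangentSpace 𝓘(ℝ, E) x}

/-- Without boundary an integral curve runs through every point; differentiate F along it at time 0.
-/
theorem IsConstantOnIntegralCurves.mvfderiv_eq_zero {F : M → ℝ}
    (h : IsConstantOnIntegralCurves F ξ) (hξ : IsSmoothField ξ) {x : M} (hF : MDiffAt F x) :
    mvfderiv 𝓘(ℝ, E) F x (ξ x) = 0 := by
  have : CompleteSpace E := FiniteDimensional.complete ℝ E
  obtain ⟨γ, rfl, hγ⟩ := exists_isMIntegralCurveAt_of_contMDiffAt_boundaryless (I := 𝓘(ℝ, E))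
    (v := ξ) (x₀ := x) 0 ((hξ x).of_le ENat.LEInfty.out)
  obtain ⟨ε, hε, hb⟩ := isMIntegralCurveAt_iff'.1 hγ
  rw [Real.ball_eq_Ioo] at hb
  have h0 : (0 : ℝ) ∈ Ioo (0 - ε) (0 + ε) := by constructor <;> linarith
  have h1 : HasMFDerivAt 𝓘(ℝ, ℝ) 𝓘(ℝ, ℝ) (F ∘ γ) 0 0 := by
    refine (hasMFDerivAt_const (F (γ 0)) (0 : ℝ)).congr_of_eventuallyEq ?_
    filter_upwards [isOpen_Ioo.mem_nhds h0] with t ht using h γ _ _ hb t ht 0 h0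
  have h2 := hF.hasMFDerivAt.comp 0 (hγ.hasMFDerivAt)
  have h3 := congrArg (fun L => L (1 : ℝ)) (hasMFDerivAt_unique h2 h1)
  change mfderiv 𝓘(ℝ, E) 𝓘(ℝ, ℝ) F (γ 0) ((1 : ℝ) • ξ (γ 0)) = (0 : ℝ) at h3
  rw [one_smul] at h3
  exact h3

variable
  [RiemannianBundle (fun x : M => TangentSpace 𝓘(ℝ, E) x)]
  [IsContMDiffRiemannianBundle 𝓘(ℝ, E) ∞ E (fun x : M => TangentSpace 𝓘(ℝ, E) x)]
  {lam : M → ℝ} {ρ : ℝ}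

/-- With L_ξ g = 0 the metric is Einstein with factor λ + ρS, so Schur's lemma applies; div ξ = 0
then gives S. Both directions of the main equivalence use it. -/
theorem IsAlmostRBSoliton.exists_eq_const [T2Space M] [ConnectedSpace M]
    (h : IsAlmostRBSoliton ξ lam ρ) (hn : 2 < Module.finrank ℝ E)
    (h0 : ∀ x v w, symmForm ξ x v w = 0) :
    ∃ c, ∀ x, lam x + ρ * scalarCurvature 𝓘(ℝ, E) x = c ∧
      scalarCurvature 𝓘(ℝ, E) x = Module.finrank ℝ E * c := by
  obtain ⟨c, hc⟩ := exists_eq_const_of_mvfderiv_eq_zero h.contMDiff_factor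
    (mvfderiv_eq_zero_of_ricci_eq h.contMDiff_factor hn.ne' fun y v w => by
      rw [h.ricci_eq, h0, sub_zero])
  refine ⟨c, fun x => ⟨hc x, ?_⟩⟩
  have h1 := h.divergence_eq x
  rw [← sum_symmForm_self (frame 𝓘(ℝ, E) x), hc] at h1
  simp only [h0, Finset.sum_const_zero] at h1
  linarith

theorem IsAlmostRBSoliton.symmForm_eq_zero_of_isConstantOnIntegralCurves [T2Space M]
    [CompactSpace M] (h : IsAlmostRBSoliton ξ lam ρ) (hn : 2 < Module.finrank ℝ E)
    (hc : IsConstantOnIntegralCurves (fun x => ((Module.finrank ℝ E : ℝ) - 1) *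
      (lam x + ρ * scalarCurvature 𝓘(ℝ, E) x) - scalarCurvature 𝓘(ℝ, E) x) ξ)
    (x : M) (v w : TangentSpace 𝓘(ℝ, E) x) : symmForm ξ x v w = 0 := by
  have hF : CMDiff ∞ (fun x : M => ((Module.finrank ℝ E : ℝ) - 1) *
      (lam x + ρ * scalarCurvature 𝓘(ℝ, E) x) - scalarCurvature 𝓘(ℝ, E) x) :=
    (contMDiff_const.mul h.contMDiff_factor).sub contMDiff_scalarCurvature
  have hdiv := fun y => h.divergence_solitonField y
    (hc.mvfderiv_eq_zero h.smooth_field (hF.mdifferentiable (by simp) y)) (frame 𝓘(ℝ, E) y)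
  -- The integer bound n > 2 is n ≥ 3, exactly what makes the coefficient (n-3)/2 nonnegative.
  have hn' : (3 : ℝ) ≤ Module.finrank ℝ E := by exact_mod_cast hn
  have hsq : ∀ y, 0 ≤ ∑ i, ∑ j,
      symmForm ξ y (frame 𝓘(ℝ, E) y i) (frame 𝓘(ℝ, E) y j) ^ 2 := fun y =>
    Finset.sum_nonneg fun i _ => Finset.sum_nonneg fun j _ => sq_nonneg _
  have hrest : ∀ y, 0 ≤ ((Module.finrank ℝ E : ℝ) - 3) / 2 * divergence ξ y ^ 2 := fun y =>
    mul_nonneg (by linarith) (sq_nonneg _)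
  have h0 := divergence_eq_zero_of_nonneg h.smoothAt_solitonField
    (fun y => by rw [hdiv y]; exact add_nonneg (hsq y) (hrest y)) x
  rw [hdiv x] at h0
  have h1 := ((add_eq_zero_iff_of_nonneg (hsq x) (hrest x)).1 h0).1
  refine symmForm_eq_zero (b := frame 𝓘(ℝ, E) x) (fun i j => ?_) v w
  have h2 := (Finset.sum_eq_zero_iff_of_nonneg fun i _ =>
    Finset.sum_nonneg fun j _ => sq_nonneg _).1 h1 i (Finset.mem_univ i)
  exact pow_eq_zero_iff two_ne_zero |>.1
    ((Finset.sum_eq_zero_iff_of_nonneg fun j _ => sq_nonneg _).1 h2 j (Finset.mem_univ j))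

theorem IsAlmostRBSoliton.isConstantOnIntegralCurves_iff [T2Space M] [CompactSpace M]
    [ConnectedSpace M] (h : IsAlmostRBSoliton ξ lam ρ) (hn : 2 < Module.finrank ℝ E) :
    IsConstantOnIntegralCurves (fun x => ((Module.finrank ℝ E : ℝ) - 1) *
      (lam x + ρ * scalarCurvature 𝓘(ℝ, E) x) - scalarCurvature 𝓘(ℝ, E) x) ξ ↔
      IsTrivialRBSoliton ξ lam ρ := by
  constructor
  · intro hc
    have h0 := h.symmForm_eq_zero_of_isConstantOnIntegralCurves hn hc
    obtain ⟨c, hc'⟩ := h.exists_eq_const hn h0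
    -- The value of λ solves λ + ρS = c with S = nc.
    refine ⟨h, ⟨c - ρ * (Module.finrank ℝ E * c), fun x => ?_⟩, h.smooth_field,
      fun X Y hX hY x => ?_⟩
    · have h1 := (hc' x).1
      rw [(hc' x).2] at h1
      linarith
    · rw [lieDerivMetric_eq_two_mul_symmForm (h.smooth_field.mdifferentiable (by simp) x)
        (hX.mdifferentiable (by simp) x) (hY.mdifferentiable (by simp) x), h0, mul_zero]
  · intro ht
    have h0 : ∀ (x : M) (v w : TangentSpace 𝓘(ℝ, E) x), symmForm ξ x v w = 0 := by
      intro x v w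
      obtain ⟨X, hX, rfl⟩ := exists_isSmoothField v
      obtain ⟨Y, hY, rfl⟩ := exists_isSmoothField w
      have h1 := ht.killing.2 X Y hX hY x
      rw [lieDerivMetric_eq_two_mul_symmForm (h.smooth_field.mdifferentiable (by simp) x)
        (hX.mdifferentiable (by simp) x) (hY.mdifferentiable (by simp) x)] at h1
      linarith
    obtain ⟨c, hc⟩ := h.exists_eq_const hn h0
    intro γ a b _ s _ t _
    change (_ - 1) * (lam (γ s) + _) - _ = (_ - 1) * (lam (γ t) + _) - _
    rw [(hc (γ s)).1, (hc (γ s)).2, (hc (γ t)).1, (hc (γ t)).2]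

end Main

end RBSoliton

end

theorem theorem4p3 (n : ℕ) (hn : 2 < n)
    {M : Type*} [TopologicalSpace M] [T2Space M] [CompactSpace M] [ConnectedSpace M]
    [ChartedSpace (EuclideanSpace ℝ (Fin n)) M] [IsManifold (𝓡 n) ∞ M]
    [RiemannianBundle (fun x : M => TangentSpace (𝓡 n) x)]
    [IsContMDiffRiemannianBundle (𝓡 n) ∞ (EuclideanSpace ℝ (Fin n))
      (fun x : M => TangentSpace (𝓡 n) x)]
    (ξ : Π x : M, TangentSpace (𝓡 n) x) (lam : M → ℝ) (ρ : ℝ)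
    (hsol : RBSoliton.IsAlmostRBSoliton ξ lam ρ)
    (hRic : ∀ x : M, RBSoliton.skewOperatorNormSq ξ x ≤ RBSoliton.ricci x (ξ x) (ξ x)) :
    RBSoliton.IsConstantOnIntegralCurves
        (fun x => ((n : ℝ) - 1) * (lam x + ρ * RBSoliton.scalarCurvature (𝓡 n) x)
          - RBSoliton.scalarCurvature (𝓡 n) x) ξ
      ↔ RBSoliton.IsTrivialRBSoliton ξ lam ρ := by
  have h := hsol.isConstantOnIntegralCurves_iff (by rwa [finrank_euclideanSpace_fin])
  rwa [finrank_euclideanSpace_fin] at h
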